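/- **Setting.** Base stations are placed at the points $X_0,X_1,\dots$ of a homogeneous Poisson point process in $\mathbb R^2$ of density $\lambda_{bs}>0$, and a typical user sits at the origin; $r_i=|X_i|$. Station $i$ transmits with power $P>0$ and its received power at the user is $|h_i|^2Pr_i^{-\alpha}$, with path loss exponent $\alpha>2$ and $|h_i|^2\sim\exp(1)$. There are $N$ files, with popularity distribution $\mathbf p=(p_1,\dots,p_N)$, $p_l\ge 0$, $\sum_l p_l=1$. Station $i$ caches a random set $\mathcal L_i$ of at most $L$ files, with $\Pr[l\in\mathcal L_i]=q_l$ for every $i$ and $l$. The pairs $(|h_i|^2,\mathcal L_i)$ are independent over $i$ and independent of the positions, and $|h_i|^2$ is independent of $\mathcal L_i$. A user that requests file $l$ is served by the station $i$ with the strongest fading-averaged received power, i.e. the nearest one, among those that cache $l$. With noise variance $\sigma^2\ge 0$ its SINR is $$\Gamma_{il}=\frac{|h_i|^2Pr_i^{-\alpha}}{\sum_{j\ne i}|h_j|^2Pr_j^{-\alpha}+\sigma^2},$$ the sum being over all other stations. For a bandwidth $W>0$ and a rate requirement $R_0>0$, the average success probability is $$P(\mathbf p,\mathbf q)=\sum_{l=1}^N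 p_l\Pr\{W\log_2(1+\Gamma_{il})\ge R_0\},$$ where $i$ is the station serving file $l$ (the event does not occur if no station caches $l$). Let $s_0=2^{R_0/W}-1$, $C=\pi\lambda_{bs}$, $$A=\frac{2\pi\lambda_{bs}s_0^{2/\alpha}}{\alpha}\int_{1/s_0}^\infty\frac{u^{2/\alpha-1}}{1+u}\,du,\qquad B=\frac{2\pi\lambda_{bs}s_0^{2/\alpha}}{\alpha}\int_0^\infty\frac{u^{2/\alpha-1}}{1+u}\,du .$$ **Corollary (interference-limited case).** In the absence of noise, $\sigma^2=0$, the average success probability equals, for every $P>0$, $$P_s(\mathbf p,\mathbf q)=\sum_{l=1}^N p_l\,g_0(q_l),\qquad g_0(q)=qC\int_0^\infty \exp\bigl[-(qA+(1-q)B+qC)\,t\bigr]\,dt\quad(t=r^2),$$ and the average success probability with noise converges to this same value at high SNR, i.e. as $P/\sigma^2\to\infty$ with $P,\sigma^2>0$. The integrals defining $A$, $B$ and $g_0$ converge, and for every $q\in[0,1]$ $$g_0(q)=\frac{qC}{qA+(1-q)B+qC}.$$ -/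

import Mathlib

open MeasureTheory ProbabilityTheory Set
open scoped ENNReal NNReal

noncomputable section

namespace CachingNetwork

/-- The plane in which the base stations live (Euclidean norm, Lebesgue measure). -/
abbrev Plane : Type := EuclideanSpace ℝ (Fin 2)

/-- The number of points of the enumerated point set `X 0 ω, X 1 ω, …` that lie in `S`. -/
def countIn {Ω : Type*} (X : ℕ → Ω → Plane) (S : Set Plane) (ω : Ω) : ℕ∞ :=
  {i : ℕ | X i ω ∈ S}.encard

/-- The random points `X 0, X 1, …` form a homogeneous Poisson point process of density `lam`:
the number of points in a Borel set of finite area is Poisson distributed with mean `lam` times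
the area, and the numbers of points in pairwise disjoint Borel sets are independent. -/
structure IsPoissonProcess {Ω : Type*} [MeasurableSpace Ω] (μ : Measure Ω)
    (lam : ℝ) (X : ℕ → Ω → Plane) : Prop where
  measurable_pos : ∀ i, Measurable (X i)
  hasLaw_count : ∀ S : Set Plane, MeasurableSet S → volume S ≠ ∞ →
    HasLaw (countIn X S)
      ((poissonMeasure (lam * (volume S).toReal).toNNReal).map (Nat.cast : ℕ → ℕ∞)) μ
  indep_count : ∀ (n : ℕ) (S : Fin n → Set Plane), (∀ k, MeasurableSet (S k)) →
    Pairwise (fun k k' => Disjoint (S k) (S k')) →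
    iIndepFun (fun k => countIn X (S k)) μ

/-- The cellular network seen by a typical user at the origin. Station `i` has position `X i`,
fading power gain `h i` towards the user and cache content `cache i`. Positions form a homogeneous
Poisson process, gains are exponential with mean `1`, caches hold at most `L` of the `N` files and
hold file `l` with probability `q l`, stations are marked independently of each other and of all
positions, and the gain of a station is independent of its cache. -/
structure IsNetwork {Ω : Type*} [MeasurableSpace Ω] (μ : Measure Ω) {N : ℕ}
    (lam : ℝ) (L : ℕ) (q : Fin N → ℝ) (X : ℕ → Ω → Plane) (h : ℕ → Ω → ℝ)
    (cache : ℕ → Ω → Set (Fin N)) : Prop where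
  poisson : IsPoissonProcess μ lam X
  measurable_gain : ∀ i, Measurable (h i)
  hasLaw_gain : ∀ i, HasLaw (h i) (expMeasure 1) μ
  measurable_cache : ∀ i, Measurable (cache i)
  card_cache_le : ∀ i, ∀ᵐ ω ∂μ, (cache i ω).ncard ≤ L
  prob_mem_cache : ∀ i l, μ.real {ω | l ∈ cache i ω} = q l
  indep_gain_cache : ∀ i, IndepFun (h i) (cache i) μ
  indep_marks : iIndepFun (fun i ω => (h i ω, cache i ω)) μ
  indep_pos_marks : IndepFun (fun ω i => X i ω) (fun ω i => (h i ω, cache i ω)) μ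

section Model

variable {Ω : Type*} {N : ℕ}

/-- Instantaneous power `|hᵢ|² P rᵢ^(-α)` received by the user from station `i`. -/
def receivedPower (α P : ℝ) (X : ℕ → Ω → Plane) (h : ℕ → Ω → ℝ) (i : ℕ) (ω : Ω) : ℝ≥0∞ :=
  ENNReal.ofReal (h i ω * P * ‖X i ω‖ ^ (-α))

/-- Interference: total power received from all stations other than `i`, as an element of
`[0, ∞]`. -/
def interference (α P : ℝ) (X : ℕ → Ω → Plane) (h : ℕ → Ω → ℝ) (i : ℕ) (ω : Ω) : ℝ≥0∞ :=
  ∑' j : {j : ℕ // j ≠ i}, receivedPower α P X h j ω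

/-- The SINR `Γ` of the link from station `i`, where `noise` is the noise variance `σ²`. -/
def sinr (α P noise : ℝ) (X : ℕ → Ω → Plane) (h : ℕ → Ω → ℝ) (i : ℕ) (ω : Ω) : ℝ :=
  (receivedPower α P X h i ω / (interference α P X h i ω + ENNReal.ofReal noise)).toReal

/-- Station `i` serves a request for file `l`: among the stations that cache `l` it is the nearest,
that is, the one whose received power, averaged over the fading, is the strongest. -/
def Serves (X : ℕ → Ω → Plane) (cache : ℕ → Ω → Set (Fin N)) (l : Fin N) (i : ℕ) (ω : Ω) :
    Prop :=
  l ∈ cache i ω ∧ ∀ j, l ∈ cache j ω → ‖X i ω‖ ≤ ‖X j ω‖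

/-- A request for file `l` succeeds: some station serves it, at a rate `W log₂ (1 + Γ)` of at
least `R₀`. -/
def successEvent (α W R₀ P noise : ℝ) (X : ℕ → Ω → Plane) (h : ℕ → Ω → ℝ)
    (cache : ℕ → Ω → Set (Fin N)) (l : Fin N) : Set Ω :=
  {ω | ∃ i, Serves X cache l i ω ∧ R₀ ≤ W * Real.logb 2 (1 + sinr α P noise X h i ω)}

/-- Average success probability for the popularity distribution `p`. -/
def avgSuccessProb [MeasurableSpace Ω] (μ : Measure Ω) (α W R₀ P noise : ℝ) (p : Fin N → ℝ)
    (X : ℕ → Ω → Plane) (h : ℕ → Ω → ℝ) (cache : ℕ → Ω → Set (Fin N)) : ℝ :=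
  ∑ l, p l * μ.real (successEvent α W R₀ P noise X h cache l)

end Model

/-- SINR threshold `s₀ = 2^(R₀/W) - 1`. -/
def threshold (W R₀ : ℝ) : ℝ := (2 : ℝ) ^ (R₀ / W) - 1

/-- The constant `A`. -/
def constA (α lam s₀ : ℝ) : ℝ :=
  2 * Real.pi * lam * s₀ ^ (2 / α) * (1 / α) * ∫ u in Ioi (1 / s₀), u ^ (2 / α - 1) / (1 + u)

/-- The constant `B`. -/
def constB (α lam s₀ : ℝ) : ℝ :=
  2 * Real.pi * lam * s₀ ^ (2 / α) * (1 / α) * ∫ u in Ioi (0 : ℝ), u ^ (2 / α - 1) / (1 + u)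

/-- The constant `C`. -/
def constC (lam : ℝ) : ℝ := Real.pi * lam

/-- The exponent rate `x A + (1 - x) B + x C`. -/
def decayRate (α lam s₀ x : ℝ) : ℝ :=
  x * constA α lam s₀ + (1 - x) * constB α lam s₀ + x * constC lam

/-- `g₀` in its integral form; the integration variable `t` is the squared distance `r²`. -/
def g₀ (α lam s₀ x : ℝ) : ℝ :=
  x * constC lam * ∫ t in Ioi (0 : ℝ), Real.exp (-(decayRate α lam s₀ x) * t)

end CachingNetwork

end

/-!
Whether a request succeeds depends on infinitely many stations as seen from the one that serves it,
so the positions have to be described around a random point of the process. Slicing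
the plane into thin shells `a ≤ ‖y‖ < b` around the user, all of the same small area, reduces this
to counts in disjoint regions; no Palm measures are needed, and equidistant stations require no
separate treatment.

If the request is served from a given shell, then the gain of the serving station exceeds a cost
contributed by the stations *outside* the shell: the weighted sum of their gains, with weights
measured from the inner radius, where a station closer than the inner radius that also caches the
file counts as an infinite cost (`cost_le_of_success`). Conversely, a station that is alone in its
shell and whose gain exceeds the cost measured from the outer radius, plus a noise term, serves the
request successfully (`serves_of_cost_le`, `rate_of_cost_le`), and these events are disjoint for
different shells and stations.

For fixed positions, the exponential law of the gain turns the probability of such an event into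
`q * ∏ⱼ E exp (-costⱼ)` (`IsNetwork.measure_cache_and_tsum_le_gain`). Averaging over the positions
is a Laplace functional of the Poisson process outside the shell, independent of the count inside
(`IsPoissonProcess.lintegral_countIn_mul_expNeg`); it is proved for simple functions from the
independence of the counts and extended by monotone approximation. In polar coordinates its exponent
is `decayRate * a ^ 2` (`lintegral_one_sub_retention`), up to the area of the shell.

With shells of area `π / n` both bounds are geometric series in `exp (-decayRate / n)`
(`IsNetwork.measureReal_success_le`, `IsNetwork.sum_le_measureReal_success`), and as `n → ∞` both
tend to `q * C / decayRate`, which is `g₀ q`. The noise only enters the lower bound, through factors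
that depend continuously on the noise-to-power ratio; this gives the limit at high signal-to-noise
ratio.
-/

namespace CachingNetwork

/-! ### The exponential `x ↦ exp (-x)` on `[0, ∞]` -/

/-- The map `x ↦ exp (-x)` from `[0, ∞]` to itself, with `expNeg ∞ = 0`. -/
noncomputable def expNeg (x : ℝ≥0∞) : ℝ≥0∞ := EReal.exp (-(x : EReal))

lemma expNeg_zero : expNeg 0 = 1 := by simp [expNeg]

lemma expNeg_top : expNeg ⊤ = 0 := by simp [expNeg]

lemma expNeg_add (x y : ℝ≥0∞) : expNeg (x + y) = expNeg x * expNeg y := by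
  unfold expNeg
  rw [← EReal.exp_add, EReal.coe_ennreal_add, EReal.neg_add, sub_eq_add_neg]
  · left; simp
  · right; simp

lemma expNeg_sum {ι : Type*} (s : Finset ι) (f : ι → ℝ≥0∞) :
    expNeg (∑ i ∈ s, f i) = ∏ i ∈ s, expNeg (f i) := by
  classical
  induction s using Finset.induction_on with
  | empty => simp [expNeg_zero]
  | insert a s ha ih => rw [Finset.sum_insert ha, Finset.prod_insert ha, expNeg_add, ih]

lemma expNeg_mul_natCast (c : ℝ≥0∞) (n : ℕ) : expNeg (c * n) = expNeg c ^ n := by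
  have := expNeg_sum (Finset.range n) (fun _ => c)
  simpa [mul_comm] using this

lemma continuous_expNeg : Continuous expNeg :=
  ENNReal.continuous_exp.comp (continuous_neg.comp continuous_coe_ennreal_ereal)

lemma measurable_expNeg : Measurable expNeg := continuous_expNeg.measurable

lemma antitone_expNeg : Antitone expNeg := fun x y h => by
  unfold expNeg
  rw [EReal.exp_le_exp_iff, EReal.neg_le_neg_iff]
  exact_mod_cast h

lemma expNeg_le_one (x : ℝ≥0∞) : expNeg x ≤ 1 := by
  rw [← expNeg_zero]; exact antitone_expNeg (zero_le)

lemma expNeg_ne_top (x : ℝ≥0∞) : expNeg x ≠ ⊤ :=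
  ((expNeg_le_one x).trans_lt ENNReal.one_lt_top).ne

lemma expNeg_ofReal {x : ℝ} (hx : 0 ≤ x) :
    expNeg (ENNReal.ofReal x) = ENNReal.ofReal (Real.exp (-x)) := by
  unfold expNeg
  rw [EReal.coe_ennreal_ofReal, max_eq_left hx, ← EReal.coe_neg, EReal.exp_coe]

/-- The inverse of `expNeg` on `[0, 1]`. -/
noncomputable def negLog (g : ℝ≥0∞) : ℝ≥0∞ := (-(ENNReal.log g)).toENNReal

lemma expNeg_negLog {g : ℝ≥0∞} (hg : g ≤ 1) : expNeg (negLog g) = g := by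
  unfold expNeg negLog
  rw [EReal.coe_toENNReal, neg_neg, ENNReal.exp_log]
  rw [EReal.neg_nonneg]
  simpa using hg

lemma negLog_one : negLog 1 = 0 := by simp [negLog]

lemma measurable_negLog : Measurable negLog := by
  unfold negLog
  exact measurable_ereal_toENNReal.comp (ENNReal.measurable_log.neg)

/-! ### Counts and the Laplace functional of the Poisson process -/

section Poisson

variable {Ω : Type*} [MeasurableSpace Ω] {μ : Measure Ω} {lam : ℝ} {X : ℕ → Ω → Plane}

omit [MeasurableSpace Ω] in
lemma tsum_indicator_eq_mul_countIn (X : ℕ → Ω → Plane) (S : Set Plane) (c : ℝ≥0∞) (ω : Ω) :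
    ∑' j, S.indicator (fun _ => c) (X j ω) = c * (countIn X S ω : ℝ≥0∞) := by
  have h := tsum_subtype {i : ℕ | X i ω ∈ S} (fun _ : ℕ => c)
  rw [ENNReal.tsum_set_const] at h
  rw [countIn, mul_comm, h]
  rfl

lemma measurable_tsum_comp (hX : ∀ i, Measurable (X i)) {f : Plane → ℝ≥0∞} (hf : Measurable f) :
    Measurable fun ω => ∑' j, f (X j ω) :=
  Measurable.tsum fun j => hf.comp (hX j)

lemma measurable_countIn (hX : ∀ i, Measurable (X i)) {S : Set Plane} (hS : MeasurableSet S) :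
    Measurable (countIn X S) := by
  have h : Measurable fun ω => (countIn X S ω : ℝ≥0∞) := by
    have := measurable_tsum_comp hX (f := S.indicator fun _ => 1) (measurable_const.indicator hS)
    simpa only [tsum_indicator_eq_mul_countIn, one_mul] using this
  refine measurable_to_countable' fun n => ?_
  have : countIn X S ⁻¹' {n} = (fun ω => (countIn X S ω : ℝ≥0∞)) ⁻¹' {(n : ℝ≥0∞)} := by
    ext ω; simp
  rw [this]
  exact h (measurableSet_singleton _)

variable (hX : IsPoissonProcess μ lam X)
include hX

lemma IsPoissonProcess.lintegral_countIn {S : Set Plane} (hS : MeasurableSet S)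
    (hfin : volume S ≠ ∞) (φ : ℕ∞ → ℝ≥0∞) :
    ∫⁻ ω, φ (countIn X S ω) ∂μ =
      ∑' n : ℕ, φ n * ENNReal.ofReal (Real.exp (-(lam * (volume S).toReal).toNNReal) *
        (lam * (volume S).toReal).toNNReal ^ n / n.factorial) := by
  rw [(hX.hasLaw_count S hS hfin).lintegral_comp (Measurable.of_discrete).aemeasurable,
    lintegral_map Measurable.of_discrete Measurable.of_discrete, lintegral_countable']
  simp_rw [poissonMeasure_singleton]

/-- Probability generating function of a Poisson count, at `exp (-c)`. -/
lemma IsPoissonProcess.lintegral_expNeg_mul_countIn (hlam : 0 < lam) {S : Set Plane}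
    (hS : MeasurableSet S) (hfin : volume S ≠ ∞) (c : ℝ≥0∞) :
    ∫⁻ ω, expNeg (c * countIn X S ω) ∂μ =
      expNeg (ENNReal.ofReal lam * (volume S * (1 - expNeg c))) := by
  rw [hX.lintegral_countIn hS hfin (fun n => expNeg (c * n))]
  simp only [ENat.toENNReal_coe, expNeg_mul_natCast]
  obtain ⟨z, hz0, hz⟩ : ∃ z : ℝ, 0 ≤ z ∧ expNeg c = ENNReal.ofReal z :=
    ⟨(expNeg c).toReal, ENNReal.toReal_nonneg, (ENNReal.ofReal_toReal (expNeg_ne_top c)).symm⟩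
  have hz1 : z ≤ 1 := by
    have := expNeg_le_one c
    rw [hz] at this
    exact ENNReal.ofReal_le_one.1 this
  have hv : volume S = ENNReal.ofReal (volume S).toReal := (ENNReal.ofReal_toReal hfin).symm
  set v := (volume S).toReal with hvdef
  have hv0 : 0 ≤ v := ENNReal.toReal_nonneg
  have hr0 : 0 ≤ lam * v := by positivity
  rw [hz, hv, Real.coe_toNNReal _ hr0]
  have h1 : (1 : ℝ≥0∞) - ENNReal.ofReal z = ENNReal.ofReal (1 - z) := by
    rw [ENNReal.ofReal_sub _ hz0, ENNReal.ofReal_one]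
  rw [h1, ← ENNReal.ofReal_mul hv0, ← ENNReal.ofReal_mul hlam.le, expNeg_ofReal
    (mul_nonneg hlam.le (mul_nonneg hv0 (by linarith)))]
  have hs := (NormedSpace.expSeries_div_hasSum_exp (lam * v * z : ℝ)).mul_left
    (Real.exp (-(lam * v)))
  rw [← Real.exp_eq_exp_ℝ, ← Real.exp_add] at hs
  have : ∀ n : ℕ, ENNReal.ofReal z ^ n *
      ENNReal.ofReal (Real.exp (-(lam * v)) * (lam * v) ^ n / n.factorial)
      = ENNReal.ofReal (Real.exp (-(lam * v)) * ((lam * v * z) ^ n / n.factorial)) := fun n => by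
    rw [← ENNReal.ofReal_pow hz0, ← ENNReal.ofReal_mul (by positivity)]
    congr 1
    rw [mul_pow (lam * v) z]
    ring
  simp_rw [this]
  rw [← ENNReal.ofReal_tsum_of_nonneg (fun n => by positivity) hs.summable, hs.tsum_eq]
  congr 2
  ring

/-- The expected number of points is the intensity times the area. -/
lemma IsPoissonProcess.lintegral_countIn_eq (hlam : 0 < lam) {S : Set Plane}
    (hS : MeasurableSet S) (hfin : volume S ≠ ∞) :
    ∫⁻ ω, (countIn X S ω : ℝ≥0∞) ∂μ = ENNReal.ofReal lam * volume S := by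
  rw [hX.lintegral_countIn hS hfin (fun n => (n : ℝ≥0∞))]
  have hv : volume S = ENNReal.ofReal (volume S).toReal := (ENNReal.ofReal_toReal hfin).symm
  set v := (volume S).toReal with hvdef
  have hv0 : 0 ≤ v := ENNReal.toReal_nonneg
  have hr0 : 0 ≤ lam * v := by positivity
  rw [hv, Real.coe_toNNReal _ hr0, ← ENNReal.ofReal_mul hlam.le, tsum_eq_zero_add' ENNReal.summable]
  have hs := (NormedSpace.expSeries_div_hasSum_exp (lam * v : ℝ)).mul_left
    (Real.exp (-(lam * v)) * (lam * v))
  rw [← Real.exp_eq_exp_ℝ, mul_right_comm, ← Real.exp_add] at hs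
  have : ∀ n : ℕ, ((n + 1 : ℕ) : ℕ∞) *
      ENNReal.ofReal (Real.exp (-(lam * v)) * (lam * v) ^ (n + 1) / (n + 1).factorial)
      = ENNReal.ofReal (Real.exp (-(lam * v)) * (lam * v) * ((lam * v) ^ n / n.factorial)) :=
      fun n => by
    rw [ENat.toENNReal_coe, ← ENNReal.ofReal_natCast, ← ENNReal.ofReal_mul (by positivity)]
    congr 1
    rw [Nat.factorial_succ]
    push_cast
    field_simp
    ring
  simp_rw [this]
  rw [← ENNReal.ofReal_tsum_of_nonneg (fun n => by positivity) hs.summable, hs.tsum_eq]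
  simp

lemma IsPoissonProcess.measure_countIn_eq_one (hlam : 0 < lam) {S : Set Plane}
    (hS : MeasurableSet S) (hfin : volume S ≠ ∞) :
    μ {ω | countIn X S ω = 1} =
      ENNReal.ofReal (lam * (volume S).toReal * Real.exp (-(lam * (volume S).toReal))) := by
  have hm : MeasurableSet {ω | countIn X S ω = 1} :=
    measurable_countIn hX.measurable_pos hS (measurableSet_singleton 1)
  have h := hX.lintegral_countIn hS hfin (Set.indicator {1} 1)
  rw [tsum_eq_single 1] at h
  · rw [← lintegral_indicator_one hm]
    have h0 : 0 ≤ lam * (volume S).toReal := by positivity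
    calc _ = ∫⁻ ω, Set.indicator {1} 1 (countIn X S ω) ∂μ := rfl
      _ = _ := by
        rw [h, Real.coe_toNNReal _ h0]
        simp [mul_comm]
  · intro n hn
    have : (n : ℕ∞) ≠ 1 := by exact_mod_cast hn
    simp [this]

/-- Counts over any finite family of disjoint sets are independent, whatever the index type. -/
lemma IsPoissonProcess.iIndepFun_countIn {ι : Type*} [Fintype ι] {S : ι → Set Plane}
    (hS : ∀ k, MeasurableSet (S k)) (hd : Pairwise fun k k' => Disjoint (S k) (S k')) :
    iIndepFun (fun k => countIn X (S k)) μ := by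
  let e := Fintype.equivFin ι
  have := hX.indep_count _ (fun k => S (e.symm k)) (fun k => hS _)
    (fun k k' hk => hd (e.symm.injective.ne hk))
  have := this.precomp e.injective
  simpa [e] using! this

lemma IsPoissonProcess.isProbabilityMeasure : IsProbabilityMeasure μ :=
  (hX.iIndepFun_countIn (ι := Fin 0) (S := fun _ => ∅) (fun _ => MeasurableSet.empty)
    (fun k => k.elim0)).isProbabilityMeasure

omit hX in
lemma sum_indicator_preimage_diff (s : SimpleFunc Plane ℝ≥0∞) {T : Set Plane}
    (hsT : ∀ y ∈ T, s y = 0) {φ : ℝ≥0∞ → ℝ≥0∞} (hφ : φ 0 = 0) (y : Plane) :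
    ∑ c : s.range, (s ⁻¹' {c.1} \ T).indicator (fun _ => φ c.1) y = φ (s y) := by
  by_cases hy : y ∈ T
  · rw [hsT y hy, hφ]
    exact Finset.sum_eq_zero fun c _ => by simp [hy]
  · rw [Finset.sum_eq_single ⟨s y, s.mem_range_self y⟩]
    · simp [hy]
    · intro c _ hc
      refine indicator_of_notMem (fun hmem => hc ?_) _
      exact Subtype.ext (by simpa using hmem.1.symm)
    · simp

/-- The Laplace functional for simple functions is the independence of the counts. -/
lemma IsPoissonProcess.lintegral_countIn_mul_expNeg_simpleFunc (hlam : 0 < lam)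
    (s : SimpleFunc Plane ℝ≥0∞) (hs : ∀ c ≠ 0, volume (s ⁻¹' {c}) ≠ ∞) {T : Set Plane}
    (hT : MeasurableSet T) (hsT : ∀ y ∈ T, s y = 0) (ψ : ℕ∞ → ℝ≥0∞) :
    ∫⁻ ω, ψ (countIn X T ω) * expNeg (∑' j, s (X j ω)) ∂μ =
      (∫⁻ ω, ψ (countIn X T ω) ∂μ) *
        expNeg (ENNReal.ofReal lam * ∫⁻ y, (1 - expNeg (s y))) := by
  have := hX.isProbabilityMeasure
  -- `none` stands for `T`, `some c` for the part of the level set of `c` outside `T`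
  let S : Option s.range → Set Plane := fun o => o.elim T fun c => s ⁻¹' {c.1} \ T
  have hS : ∀ o, MeasurableSet (S o) := by
    rintro (_ | c)
    · exact hT
    · exact (s.measurableSet_preimage _).diff hT
  have hd : Pairwise fun o o' => Disjoint (S o) (S o') := by
    rintro (_ | c) (_ | c') hne
    · exact absurd rfl hne
    · exact disjoint_sdiff_right
    · exact disjoint_sdiff_left
    · refine Set.disjoint_left.2 fun y hy hy' => hne ?_
      have h1 : s y = c.1 := hy.1
      have h2 : s y = c'.1 := hy'.1
      exact congrArg some (Subtype.ext (h1.symm.trans h2))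
  let φ : Option s.range → ℕ∞ → ℝ≥0∞ := fun o n => o.elim (ψ n) fun c => expNeg (c.1 * n)
  have hind := (hX.iIndepFun_countIn hS hd).comp φ fun o => Measurable.of_discrete
  have hprod := lintegral_prod_eq_prod_lintegral_of_indepFun Finset.univ _ hind fun o =>
    Measurable.of_discrete.comp (measurable_countIn hX.measurable_pos (hS o))
  simp only [Fintype.prod_option, Function.comp, S, φ, Option.elim] at hprod
  have hsum : ∀ ω, ∑ c : s.range, c.1 * (countIn X (s ⁻¹' {c.1} \ T) ω : ℝ≥0∞)
      = ∑' j, s (X j ω) := fun ω => by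
    simp_rw [← tsum_indicator_eq_mul_countIn]
    rw [← Summable.tsum_finsetSum fun _ _ => ENNReal.summable]
    exact tsum_congr fun j => sum_indicator_preimage_diff s hsT (φ := id) rfl _
  simp_rw [← expNeg_sum, hsum] at hprod
  rw [hprod]
  congr 1
  have hfac : ∀ c : s.range, ∫⁻ ω, expNeg (c.1 * (countIn X (s ⁻¹' {c.1} \ T) ω)) ∂μ =
      expNeg (ENNReal.ofReal lam * (volume (s ⁻¹' {c.1} \ T) * (1 - expNeg c.1))) := fun c => by
    rcases eq_or_ne c.1 0 with h0 | h0
    · simp [h0, expNeg_zero]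
    · exact hX.lintegral_expNeg_mul_countIn hlam (hS (some c))
        (measure_ne_top_of_subset sdiff_subset (hs _ h0)) _
  simp_rw [hfac]
  rw [← expNeg_sum, ← Finset.mul_sum]
  congr 2
  simp_rw [← sum_indicator_preimage_diff s hsT (φ := fun x => 1 - expNeg x) (by simp [expNeg_zero])]
  rw [lintegral_finsetSum]
  · refine Finset.sum_congr rfl fun c _ => ?_
    rw [lintegral_indicator_const (show MeasurableSet (s ⁻¹' {c.1} \ T) from hS (some c)), mul_comm]
  · exact fun c _ => measurable_const.indicator (hS (some c))

/-- The Laplace functional of the Poisson process, jointly with the number of points in a set on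
which the test function vanishes. -/
theorem IsPoissonProcess.lintegral_countIn_mul_expNeg (hlam : 0 < lam)
    {f : Plane → ℝ≥0∞} (hf : Measurable f) {T : Set Plane}
    (hT : MeasurableSet T) (hfT : ∀ y ∈ T, f y = 0) (ψ : ℕ∞ → ℝ≥0∞)
    (hψ : ∫⁻ ω, ψ (countIn X T ω) ∂μ ≠ ∞) :
    ∫⁻ ω, ψ (countIn X T ω) * expNeg (∑' j, f (X j ω)) ∂μ =
      (∫⁻ ω, ψ (countIn X T ω) ∂μ) *
        expNeg (ENNReal.ofReal lam * ∫⁻ y, (1 - expNeg (f y))) := by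
  have := hX.isProbabilityMeasure
  let B : ℕ → Set Plane := fun n => Metric.ball 0 n
  have hB : ∀ n, MeasurableSet (B n) := fun n => measurableSet_ball
  have hBmono : Monotone B := fun m n hmn => Metric.ball_subset_ball (by exact_mod_cast hmn)
  -- cutting off to balls gives the nonzero level sets finite area
  let s : ℕ → SimpleFunc Plane ℝ≥0∞ := fun n => (SimpleFunc.eapprox f n).restrict (B n)
  have hs_apply : ∀ n y, s n y = (B n).indicator (SimpleFunc.eapprox f n) y := fun n y => by
    rw [SimpleFunc.restrict_apply _ (hB n)]
  have hs_mono : ∀ y, Monotone fun n => s n y := fun y m n hmn => by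
    simp only [hs_apply]
    refine (indicator_le_indicator_of_subset (hBmono hmn) (fun _ => zero_le) y).trans ?_
    exact indicator_le_indicator (SimpleFunc.monotone_eapprox f hmn y)
  have hs_le : ∀ n y, s n y ≤ f y := fun n y => by
    rw [hs_apply, ← SimpleFunc.iSup_eapprox_apply hf y]
    exact (indicator_le_self' (fun _ _ => zero_le) y).trans
      (le_iSup (fun n => SimpleFunc.eapprox f n y) n)
  have hs_sup : ∀ y, ⨆ n, s n y = f y := fun y => by
    refine le_antisymm (iSup_le fun n => hs_le n y) ?_
    rw [← SimpleFunc.iSup_eapprox_apply hf y]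
    refine iSup_le fun n => ?_
    obtain ⟨m, hm⟩ := exists_nat_gt ‖y‖
    refine le_trans ?_ (le_iSup (fun n => s n y) (max n m))
    have hy : y ∈ B (max n m) := by
      have : (m : ℝ) ≤ ((max n m : ℕ) : ℝ) := by exact_mod_cast le_max_right n m
      simpa [B] using hm.trans_le this
    show SimpleFunc.eapprox f n y ≤ s (max n m) y
    rw [hs_apply, indicator_of_mem hy]
    exact SimpleFunc.monotone_eapprox f (le_max_left n m) y
  have hs_vol : ∀ n, ∀ c ≠ 0, volume (s n ⁻¹' {c}) ≠ ∞ := fun n c hc => by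
    refine measure_ne_top_of_subset (s := B n) (fun y hy => ?_)
      (measure_ball_lt_top (μ := (volume : Measure Plane))).ne
    by_contra hyB
    have : s n y = c := hy
    rw [hs_apply, indicator_of_notMem hyB] at this
    exact hc this.symm
  have hs_T : ∀ n, ∀ y ∈ T, s n y = 0 := fun n y hy => le_antisymm (hfT y hy ▸ hs_le n y) zero_le
  have key := fun n =>
    hX.lintegral_countIn_mul_expNeg_simpleFunc hlam (s n) (hs_vol n) hT (hs_T n) ψ
  have hmeas : ∀ n, Measurable fun ω => ψ (countIn X T ω) * expNeg (∑' j, s n (X j ω)) := fun n =>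
    (Measurable.of_discrete.comp (measurable_countIn hX.measurable_pos hT)).mul
      (measurable_expNeg.comp (measurable_tsum_comp hX.measurable_pos (s n).measurable))
  -- dominated convergence on the left, monotone convergence on the right
  have hpt : ∀ ω, Filter.Tendsto (fun n => expNeg (∑' j, s n (X j ω))) Filter.atTop
      (nhds (expNeg (∑' j, f (X j ω)))) := fun ω => by
    refine (continuous_expNeg.tendsto _).comp ?_
    have h1 : Monotone fun n => ∑' j, s n (X j ω) := fun m n hmn =>
      ENNReal.tsum_le_tsum fun j => hs_mono _ hmn
    have h2 : ⨆ n, ∑' j, s n (X j ω) = ∑' j, f (X j ω) := by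
      simp_rw [← lintegral_count, ← hs_sup]
      exact (lintegral_iSup (f := fun n j => s n (X j ω)) (fun n => Measurable.of_discrete)
        (fun m n hmn j => hs_mono _ hmn)).symm
    exact h2 ▸ tendsto_atTop_iSup h1
  have hψfin : ∀ᵐ ω ∂μ, ψ (countIn X T ω) < ∞ :=
    ae_lt_top (Measurable.of_discrete.comp (measurable_countIn hX.measurable_pos hT)) hψ
  have hL := tendsto_lintegral_of_dominated_convergence (fun ω => ψ (countIn X T ω)) hmeas
    (fun n => Filter.Eventually.of_forall fun ω => mul_le_of_le_one_right' (expNeg_le_one _)) hψ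
    (hψfin.mono fun ω hω => ENNReal.Tendsto.const_mul (hpt ω) (Or.inr hω.ne))
  refine tendsto_nhds_unique hL ?_
  simp_rw [key]
  refine ENNReal.Tendsto.const_mul ((continuous_expNeg.tendsto _).comp ?_) (Or.inr hψ)
  refine ENNReal.Tendsto.const_mul ?_ (Or.inr ENNReal.ofReal_ne_top)
  refine lintegral_tendsto_of_tendsto_of_monotone
    (fun n => (measurable_const.sub (measurable_expNeg.comp (s n).measurable)).aemeasurable)
    (Filter.Eventually.of_forall fun y m n hmn =>
      tsub_le_tsub_left (antitone_expNeg (hs_mono y hmn)) 1)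
    (Filter.Eventually.of_forall fun y => ?_)
  have h1 : Filter.Tendsto (fun n => s n y) Filter.atTop (nhds (f y)) :=
    hs_sup y ▸ tendsto_atTop_iSup (hs_mono y)
  exact ENNReal.Tendsto.sub tendsto_const_nhds ((continuous_expNeg.tendsto _).comp h1)
    (Or.inl ENNReal.one_ne_top)

end Poisson

/-! ### Exponential gains -/

section Marks

variable {Ω : Type*} [MeasurableSpace Ω] {μ : Measure Ω}

lemma expMeasure_setOf_le_ofReal (y : ℝ≥0∞) :
    expMeasure 1 {x | y ≤ ENNReal.ofReal x} = expNeg y := by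
  have := isProbabilityMeasure_expMeasure one_pos
  induction y with
  | top => simp [expNeg_top]
  | coe v =>
    rcases eq_or_ne v 0 with rfl | hv
    · simp [expNeg_zero]
    have hv0 : (0 : ℝ) < v := by positivity
    have hset : {x : ℝ | (v : ℝ≥0∞) ≤ ENNReal.ofReal x} = Ici (v : ℝ) := by
      ext x
      rw [mem_ofPred_eq, mem_Ici, ← ENNReal.ofReal_coe_nnreal]
      refine ⟨fun h => ?_, fun h => ENNReal.ofReal_le_ofReal h⟩
      by_contra! hx
      exact absurd h (not_le.2 ((ENNReal.ofReal_lt_ofReal_iff hv0).2 hx))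
    have hac : expMeasure 1 ≪ volume := withDensity_absolutelyContinuous _ _
    have hIci : expMeasure 1 (Ici (v : ℝ)) = expMeasure 1 (Iic (v : ℝ))ᶜ := by
      rw [compl_Iic]
      exact measure_congr (hac.ae_le Ioi_ae_eq_Ici.symm)
    rw [hset, hIci, prob_compl_eq_one_sub measurableSet_Iic, ← ofReal_cdf,
      cdf_expMeasure_eq one_pos, if_pos hv0.le, ← ENNReal.ofReal_coe_nnreal, expNeg_ofReal hv0.le,
      ← ENNReal.ofReal_one, ← ENNReal.ofReal_sub _ (by simp [hv0.le])]
    congr 1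
    simp

/-- The Laplace transform of an exponential variable of mean `1`. -/
lemma lintegral_expNeg_mul_expMeasure {w : ℝ≥0∞} (hw : w ≠ ∞) :
    ∫⁻ x, expNeg (ENNReal.ofReal x * w) ∂(expMeasure 1) = (1 + w)⁻¹ := by
  lift w to ℝ≥0 using hw
  have hw0 : (0 : ℝ) < 1 + w := by positivity
  have hinv : (1 + (w : ℝ≥0∞))⁻¹ = ENNReal.ofReal ((1 + w : ℝ)⁻¹) := by
    rw [ENNReal.ofReal_inv_of_pos hw0, ENNReal.ofReal_add zero_le_one w.coe_nonneg,
      ENNReal.ofReal_one, ENNReal.ofReal_coe_nnreal]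
  have hm : Measurable fun x => expNeg (ENNReal.ofReal x * w) :=
    measurable_expNeg.comp (ENNReal.measurable_ofReal.mul_const _)
  have hpdf : ∀ r, Measurable (exponentialPDF r) := fun r =>
    (measurable_exponentialPDFReal r).ennreal_ofReal
  have : expMeasure 1 = volume.withDensity (exponentialPDF 1) := rfl
  rw [this, lintegral_withDensity_eq_lintegral_mul _ (hpdf 1) hm, hinv]
  calc _ = ∫⁻ x, ENNReal.ofReal ((1 + w : ℝ)⁻¹) * exponentialPDF (1 + w) x := by
        refine lintegral_congr fun x => ?_
        rw [Pi.mul_apply]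
        rcases lt_or_ge x 0 with hx | hx
        · simp [exponentialPDF_of_neg hx]
        · rw [exponentialPDF_of_nonneg hx, exponentialPDF_of_nonneg hx, ← ENNReal.ofReal_coe_nnreal,
            ← ENNReal.ofReal_mul hx, expNeg_ofReal (by positivity),
            ← ENNReal.ofReal_mul (by positivity), ← ENNReal.ofReal_mul (by positivity), one_mul,
            one_mul, ← Real.exp_add, inv_mul_cancel_left₀ hw0.ne']
          congr 2
          ring
    _ = _ := by
        rw [lintegral_const_mul _ (hpdf _), lintegral_exponentialPDF_eq_one hw0, mul_one]

/-- Conditioning on the first of two independent variables. -/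
lemma measure_setOf_pair_mem {E F : Type*} [MeasurableSpace E] [MeasurableSpace F]
    [IsProbabilityMeasure μ] {U : Ω → E} {V : Ω → F} (hU : Measurable U) (hV : Measurable V)
    (h : IndepFun U V μ) {S : Set (E × F)} (hS : MeasurableSet S) :
    μ {ω | (U ω, V ω) ∈ S} = ∫⁻ ω, μ {ω' | (U ω, V ω') ∈ S} ∂μ := by
  have h1 := (indepFun_iff_map_prod_eq_prod_map_map hU.aemeasurable hV.aemeasurable).1 h
  have h2 : μ {ω | (U ω, V ω) ∈ S} = μ.map (fun ω => (U ω, V ω)) S :=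
    (Measure.map_apply (hU.prodMk hV) hS).symm
  rw [h2, h1, Measure.prod_apply hS, lintegral_map (measurable_measure_prodMk_left hS) hU]
  refine lintegral_congr fun ω => ?_
  rw [Measure.map_apply hV (measurable_prodMk_left hS)]
  rfl

/-! ### Conditional success probability given the positions -/

variable {N L : ℕ} {lam : ℝ} {q : Fin N → ℝ} {X : ℕ → Ω → Plane} {h : ℕ → Ω → ℝ}
  {cache : ℕ → Ω → Set (Fin N)}

lemma measurableSet_mem_snd (l : Fin N) : MeasurableSet {m : ℝ × Set (Fin N) | l ∈ m.2} :=
  measurable_snd (measurableSet_mem l)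

variable (hnet : IsNetwork μ lam L q X h cache)
include hnet

lemma IsNetwork.measurable_mark (i : ℕ) : Measurable fun ω => (h i ω, cache i ω) :=
  (hnet.measurable_gain i).prodMk (hnet.measurable_cache i)

lemma IsNetwork.q_nonneg (l : Fin N) : 0 ≤ q l := hnet.prob_mem_cache 0 l ▸ measureReal_nonneg

lemma IsNetwork.measurableSet_cache (i : ℕ) (l : Fin N) : MeasurableSet {ω | l ∈ cache i ω} :=
  hnet.measurable_mark i (measurableSet_mem_snd l)

lemma IsNetwork.q_le_one [IsProbabilityMeasure μ] (l : Fin N) : q l ≤ 1 :=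
  hnet.prob_mem_cache 0 l ▸ measureReal_le_one

lemma IsNetwork.measure_cache [IsProbabilityMeasure μ] (i : ℕ) (l : Fin N) :
    μ {ω | l ∈ cache i ω} = ENNReal.ofReal (q l) := by
  rw [← hnet.prob_mem_cache i l, ofReal_measureReal]

/-- A station with an independent threshold `U` for its gain. -/
lemma IsNetwork.measure_cache_and_le_gain [IsProbabilityMeasure μ] (l : Fin N) (i : ℕ)
    {U : Ω → ℝ≥0∞} (hU : Measurable U) (hind : IndepFun U (fun ω => (h i ω, cache i ω)) μ) :
    μ {ω | l ∈ cache i ω ∧ U ω ≤ ENNReal.ofReal (h i ω)} =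
      ENNReal.ofReal (q l) * ∫⁻ ω, expNeg (U ω) ∂μ := by
  have hS : MeasurableSet {z : ℝ≥0∞ × ℝ × Set (Fin N) | l ∈ z.2.2 ∧ z.1 ≤ ENNReal.ofReal z.2.1} :=
    (measurable_snd (measurableSet_mem_snd l)).inter
      (measurableSet_le measurable_fst (measurable_fst.comp measurable_snd).ennreal_ofReal)
  have key := measure_setOf_pair_mem hU (hnet.measurable_mark i) hind hS
  simp only [mem_ofPred_eq] at key
  rw [key, ← lintegral_const_mul (f := fun ω => expNeg (U ω)) _ (measurable_expNeg.comp hU)]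
  refine lintegral_congr fun ω => ?_
  have hle : MeasurableSet {x : ℝ | U ω ≤ ENNReal.ofReal x} :=
    measurableSet_le measurable_const ENNReal.measurable_ofReal
  have hl : MeasurableSet {s : Set (Fin N) | l ∈ s} := measurableSet_mem l
  have := (hnet.indep_gain_cache i).measure_inter_preimage_eq_mul _ _ hle hl
  rw [show {ω' | l ∈ cache i ω' ∧ U ω ≤ ENNReal.ofReal (h i ω')} =
    h i ⁻¹' {x | U ω ≤ ENNReal.ofReal x} ∩ cache i ⁻¹' {s | l ∈ s} by ext; simp [and_comm], this,
    mul_comm]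
  congr 1
  · exact hnet.measure_cache i l
  · rw [← expMeasure_setOf_le_ofReal, ← (hnet.hasLaw_gain i).map_eq,
      Measure.map_apply (hnet.measurable_gain i) hle]

/-- The threshold may be a sum over all other stations of costs that depend on their marks. -/
lemma IsNetwork.measure_cache_and_tsum_le_gain [IsProbabilityMeasure μ] (l : Fin N) (i : ℕ)
    (d : ℝ≥0∞) {ζ : ℕ → ℝ × Set (Fin N) → ℝ≥0∞} (hζ : ∀ j, Measurable (ζ j))
    (hζi : ∀ m, ζ i m = 0) {f : ℕ → ℝ≥0∞}
    (hf : ∀ j, expNeg (f j) = ∫⁻ ω, expNeg (ζ j (h j ω, cache j ω)) ∂μ) (hfi : f i = 0) :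
    μ {ω | l ∈ cache i ω ∧ ∑' j, ζ j (h j ω, cache j ω) + d ≤ ENNReal.ofReal (h i ω)} =
      ENNReal.ofReal (q l) * (expNeg d * expNeg (∑' j, f j)) := by
  have hmark := hnet.measurable_mark
  have hZ : ∀ j, Measurable fun ω => ζ j (h j ω, cache j ω) := fun j => (hζ j).comp (hmark j)
  have hfin : ∀ n, μ {ω | l ∈ cache i ω ∧
      ∑ j ∈ Finset.range n, ζ j (h j ω, cache j ω) + d ≤ ENNReal.ofReal (h i ω)} =
      ENNReal.ofReal (q l) * (expNeg d * expNeg (∑ j ∈ Finset.range n, f j)) := fun n => by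
    have e1 : ∀ ω, ∑ j ∈ Finset.range n, ζ j (h j ω, cache j ω) =
        ∑ j ∈ (Finset.range n).erase i, ζ j (h j ω, cache j ω) := fun ω =>
      (Finset.sum_erase (f := fun j => ζ j (h j ω, cache j ω)) _ (hζi _)).symm
    have e2 : ∑ j ∈ Finset.range n, f j = ∑ j ∈ (Finset.range n).erase i, f j :=
      (Finset.sum_erase _ hfi).symm
    simp_rw [e1, e2]
    set F := (Finset.range n).erase i with hF
    have hUm : Measurable fun ω => ∑ j ∈ F, ζ j (h j ω, cache j ω) + d :=
      (Finset.measurable_fun_sum F fun j _ => hZ j).add_const d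
    have hind : IndepFun (fun ω => ∑ j ∈ F, ζ j (h j ω, cache j ω) + d)
        (fun ω => (h i ω, cache i ω)) μ := by
      have h0 := hnet.indep_marks.indepFun_finset F {i}
        (Finset.disjoint_singleton_right.2 (Finset.notMem_erase i _)) hmark
      have heval : Measurable fun v : ({i} : Finset ℕ) → ℝ × Set (Fin N) =>
          v ⟨i, Finset.mem_singleton_self i⟩ := measurable_pi_apply _
      have h1 := h0.comp (φ := fun v : F → ℝ × Set (Fin N) => ∑ j : F, ζ j (v j) + d)
        (ψ := fun v : ({i} : Finset ℕ) → ℝ × Set (Fin N) => v ⟨i, Finset.mem_singleton_self i⟩)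
        ((Finset.measurable_fun_sum Finset.univ fun (j : F) _ =>
          (hζ j).comp (measurable_pi_apply j)).add_const d)
        heval
      convert! h1 using 2 with ω
      simp only [Function.comp]
      rw [Finset.sum_coe_sort F fun j => ζ j (h j ω, cache j ω)]
    rw [hnet.measure_cache_and_le_gain l i hUm hind]
    congr 1
    simp_rw [expNeg_add, expNeg_sum, hf]
    rw [lintegral_mul_const (f := fun ω => ∏ j ∈ F, expNeg (ζ j (h j ω, cache j ω))) _
      (Finset.measurable_fun_prod F fun j _ => measurable_expNeg.comp (hZ j)), mul_comm]
    congr 1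
    exact lintegral_prod_eq_prod_lintegral_of_indepFun F _
      (hnet.indep_marks.comp (fun j m => expNeg (ζ j m)) fun j => measurable_expNeg.comp (hζ j))
      fun j => measurable_expNeg.comp (hZ j)
  let E : ℕ → Set Ω := fun n => {ω | l ∈ cache i ω ∧
      ∑ j ∈ Finset.range n, ζ j (h j ω, cache j ω) + d ≤ ENNReal.ofReal (h i ω)}
  have hE : ∀ n, MeasurableSet (E n) := fun n =>
    (hnet.measurableSet_cache i l).inter (measurableSet_le
      ((Finset.measurable_fun_sum _ fun j _ => hZ j).add_const d)
      (hnet.measurable_gain i).ennreal_ofReal)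
  have hEanti : Antitone E := fun m n hmn ω hω =>
    ⟨hω.1, le_trans (add_le_add_left (Finset.sum_le_sum_of_subset (Finset.range_mono hmn)) d) hω.2⟩
  have hEinter : {ω | l ∈ cache i ω ∧ ∑' j, ζ j (h j ω, cache j ω) + d ≤ ENNReal.ofReal (h i ω)}
      = ⋂ n, E n := by
    ext ω
    simp only [mem_ofPred_eq, mem_iInter, E, ENNReal.tsum_eq_iSup_nat, ENNReal.iSup_add,
      iSup_le_iff]
    exact ⟨fun H n => ⟨H.1, H.2 n⟩, fun H => ⟨(H 0).1, fun n => (H n).2⟩⟩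
  have hlim := tendsto_measure_iInter_atTop (μ := μ) (fun n => (hE n).nullMeasurableSet) hEanti
    ⟨0, measure_ne_top _ _⟩
  rw [hEinter]
  refine tendsto_nhds_unique hlim ?_
  simp only [Function.comp_def, E, hfin]
  refine ENNReal.Tendsto.const_mul (ENNReal.Tendsto.const_mul
    ((continuous_expNeg.tendsto _).comp ENNReal.summable.hasSum.tendsto_sum_nat)
    (Or.inr (expNeg_ne_top _))) (Or.inr ENNReal.ofReal_ne_top)

end Marks

/-! ### Averaging over the positions -/

section Shell

variable {Ω : Type*} [MeasurableSpace Ω] {μ : Measure Ω} {N L : ℕ} {lam : ℝ} {q : Fin N → ℝ}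
  {X : ℕ → Ω → Plane} {h : ℕ → Ω → ℝ} {cache : ℕ → Ω → Set (Fin N)}

open Classical in
/-- What a station at `y` with mark `m = (gain, cache)` contributes to the threshold that the gain
of the serving station has to reach: its weighted gain, and `∞` if it caches file `l` while lying
in the exclusion region `B`, as it would then serve the request itself. -/
noncomputable def stationCost (l : Fin N) (w : Plane → ℝ≥0∞) (B : Set Plane) (y : Plane)
    (m : ℝ × Set (Fin N)) : ℝ≥0∞ :=
  ENNReal.ofReal m.1 * w y + if y ∈ B ∧ l ∈ m.2 then ⊤ else 0

open Classical in
/-- The mean of `exp (-cost)` for a station at `y` that caches the file with probability `x`. -/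
noncomputable def retention (x : ℝ) (w : Plane → ℝ≥0∞) (B : Set Plane) (y : Plane) : ℝ≥0∞ :=
  (1 + w y)⁻¹ * if y ∈ B then ENNReal.ofReal (1 - x) else 1

lemma measurable_stationCost (l : Fin N) {w : Plane → ℝ≥0∞} (hw : Measurable w) {B : Set Plane}
    (hB : MeasurableSet B) :
    Measurable fun z : Plane × (ℝ × Set (Fin N)) => stationCost l w B z.1 z.2 := by
  unfold stationCost
  refine ((measurable_fst.comp measurable_snd).ennreal_ofReal.mul (hw.comp measurable_fst)).add ?_
  exact Measurable.ite ((measurable_fst hB).inter (measurable_snd (measurableSet_mem_snd l)))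
    measurable_const measurable_const

lemma measurable_retention (x : ℝ) {w : Plane → ℝ≥0∞} (hw : Measurable w) {B : Set Plane}
    (hB : MeasurableSet B) : Measurable (retention x w B) := by
  unfold retention
  exact (measurable_const.add hw).inv.mul (Measurable.ite hB measurable_const measurable_const)

lemma retention_le_one {x : ℝ} (hx : 0 ≤ x) (w : Plane → ℝ≥0∞) (B : Set Plane) (y : Plane) :
    retention x w B y ≤ 1 := by
  unfold retention
  refine mul_le_one' (ENNReal.inv_le_one.2 le_self_add) ?_
  split_ifs
  · rw [ENNReal.ofReal_le_one]; linarith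
  · exact le_rfl

/-- The count `n` itself if `n ∈ Q`, and `0` otherwise: each of the `n` stations in a shell is a
candidate for serving the request, so the count appears as a weight. -/
noncomputable def countWeight (Q : Set ℕ∞) (n : ℕ∞) : ℝ≥0∞ := Q.indicator (fun n => (n : ℝ≥0∞)) n

variable [IsProbabilityMeasure μ] (hnet : IsNetwork μ lam L q X h cache)
include hnet

open Classical in
lemma IsNetwork.lintegral_expNeg_stationCost (l : Fin N) (j : ℕ) {w : Plane → ℝ≥0∞}
    {B : Set Plane} {y : Plane} (hwy : w y ≠ ∞) :
    ∫⁻ ω, expNeg (stationCost l w B y (h j ω, cache j ω)) ∂μ = retention (q l) w B y := by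
  have hgain : ∫⁻ ω, expNeg (ENNReal.ofReal (h j ω) * w y) ∂μ = (1 + w y)⁻¹ := by
    rw [(hnet.hasLaw_gain j).lintegral_comp (f := fun x => expNeg (ENNReal.ofReal x * w y))
      (measurable_expNeg.comp (ENNReal.measurable_ofReal.mul_const _)).aemeasurable,
      lintegral_expNeg_mul_expMeasure hwy]
  unfold stationCost retention
  by_cases hy : y ∈ B
  · simp only [hy, true_and, if_true, expNeg_add]
    have hmc : MeasurableSet {ω | l ∈ cache j ω}ᶜ := (hnet.measurableSet_cache j l).compl
    have hl : MeasurableSet {s : Set (Fin N) | l ∈ s}ᶜ := (measurableSet_mem l).compl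
    have e : ∀ ω, (expNeg (if l ∈ cache j ω then ⊤ else 0) : ℝ≥0∞) =
        ({s : Set (Fin N) | l ∈ s}ᶜ.indicator 1 (cache j ω) : ℝ≥0∞) := fun ω => by
      by_cases hc : l ∈ cache j ω <;> simp [hc, expNeg_zero, expNeg_top]
    simp_rw [e]
    have hind := (hnet.indep_gain_cache j).comp
      (φ := fun x => expNeg (ENNReal.ofReal x * w y))
      (ψ := ({s : Set (Fin N) | l ∈ s}ᶜ).indicator (1 : Set (Fin N) → ℝ≥0∞))
      (measurable_expNeg.comp (ENNReal.measurable_ofReal.mul_const _))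
      (measurable_one.indicator hl)
    have := lintegral_mul_eq_lintegral_mul_lintegral_of_indepFun
      ((measurable_expNeg.comp (ENNReal.measurable_ofReal.mul_const (w y))).comp
        (hnet.measurable_gain j))
      ((measurable_one.indicator hl).comp (hnet.measurable_cache j)) hind
    simp only [Pi.mul_apply, Function.comp_apply] at this
    rw [this, hgain]
    congr 1
    calc _ = ∫⁻ ω, ({ω | l ∈ cache j ω}ᶜ).indicator 1 ω ∂μ := rfl
      _ = _ := by
        rw [lintegral_indicator_one hmc, prob_compl_eq_one_sub (hnet.measurableSet_cache j l),
          hnet.measure_cache, ENNReal.ofReal_sub _ (hnet.q_nonneg l), ENNReal.ofReal_one]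
  · simpa [hy] using hgain

/-- Expected number of stations in `T` that cache `l` and whose gain exceeds the total cost of the
others, on the event that the number of stations in `T` lies in `Q`. -/
theorem IsNetwork.tsum_measure_shell (hlam : 0 < lam) (l : Fin N)
    {w : Plane → ℝ≥0∞} (hw : Measurable w) (hwfin : ∀ y, w y ≠ ∞) {B T : Set Plane}
    (hB : MeasurableSet B) (hT : MeasurableSet T) (hTfin : volume T ≠ ∞) (hBT : Disjoint B T)
    (hwT : ∀ y ∈ T, w y = 0) (d : ℝ≥0∞) (Q : Set ℕ∞) :
    ∑' i, μ {ω | X i ω ∈ T ∧ countIn X T ω ∈ Q ∧ l ∈ cache i ω ∧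
        ∑' j, stationCost l w B (X j ω) (h j ω, cache j ω) + d ≤ ENNReal.ofReal (h i ω)} =
      ENNReal.ofReal (q l) * expNeg d * ((∫⁻ ω, countWeight Q (countIn X T ω) ∂μ) *
        expNeg (ENNReal.ofReal lam * ∫⁻ y, (1 - retention (q l) w B y))) := by
  have hXm := hnet.poisson.measurable_pos
  let f : Plane → ℝ≥0∞ := fun y => negLog (retention (q l) w B y)
  have hf : Measurable f := measurable_negLog.comp (measurable_retention _ hw hB)
  have hfe : ∀ y, expNeg (f y) = retention (q l) w B y := fun y =>
    expNeg_negLog (retention_le_one (hnet.q_nonneg l) w B y)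
  have hTB : ∀ y ∈ T, y ∉ B := fun y hy hyB => Set.disjoint_left.1 hBT hyB hy
  have hfT : ∀ y ∈ T, f y = 0 := fun y hy => by
    simp [f, retention, hwT y hy, hTB y hy, negLog_one]
  have hcost := measurable_stationCost l hw hB
  -- the probability of each event, by conditioning on the positions
  have hi : ∀ i, μ {ω | X i ω ∈ T ∧ countIn X T ω ∈ Q ∧ l ∈ cache i ω ∧
        ∑' j, stationCost l w B (X j ω) (h j ω, cache j ω) + d ≤ ENNReal.ofReal (h i ω)} =
      ENNReal.ofReal (q l) * expNeg d * ∫⁻ ω, T.indicator 1 (X i ω) *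
        (Q.indicator 1 (countIn X T ω) * expNeg (∑' j, f (X j ω))) ∂μ := fun i => by
    let V : Set ((ℕ → Plane) × (ℕ → ℝ × Set (Fin N))) :=
      {z | z.1 i ∈ T ∧ countIn (fun j (x : ℕ → Plane) => x j) T z.1 ∈ Q ∧ l ∈ (z.2 i).2 ∧
        ∑' j, stationCost l w B (z.1 j) (z.2 j) + d ≤ ENNReal.ofReal (z.2 i).1}
    have hmi : Measurable fun z : (ℕ → Plane) × (ℕ → ℝ × Set (Fin N)) => z.2 i :=
      (measurable_pi_apply i).comp measurable_snd
    have hV1 : MeasurableSet {z : (ℕ → Plane) × (ℕ → ℝ × Set (Fin N)) | z.1 i ∈ T} :=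
      ((measurable_pi_apply i).comp measurable_fst) hT
    have hV2 : MeasurableSet {z : (ℕ → Plane) × (ℕ → ℝ × Set (Fin N)) |
        countIn (fun j (x : ℕ → Plane) => x j) T z.1 ∈ Q} :=
      ((measurable_countIn (fun j => measurable_pi_apply j) hT).comp measurable_fst)
        (MeasurableSet.of_discrete (s := Q))
    have hV3 : MeasurableSet {z : (ℕ → Plane) × (ℕ → ℝ × Set (Fin N)) | l ∈ (z.2 i).2} :=
      hmi (measurableSet_mem_snd l)
    have hV4 : MeasurableSet {z : (ℕ → Plane) × (ℕ → ℝ × Set (Fin N)) |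
        ∑' j, stationCost l w B (z.1 j) (z.2 j) + d ≤ ENNReal.ofReal (z.2 i).1} :=
      measurableSet_le ((Measurable.tsum fun j =>
        hcost.comp (((measurable_pi_apply j).comp measurable_fst).prodMk
          ((measurable_pi_apply j).comp measurable_snd))).add_const d)
        (measurable_fst.comp hmi).ennreal_ofReal
    have hV : MeasurableSet V := hV1.inter (hV2.inter (hV3.inter hV4))
    have key := measure_setOf_pair_mem (measurable_pi_lambda _ hXm)
      (measurable_pi_lambda _ hnet.measurable_mark) hnet.indep_pos_marks hV
    refine key.trans ?_
    have hm1 : Measurable fun ω => (T.indicator 1 (X i ω) : ℝ≥0∞) :=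
      (measurable_one.indicator hT).comp (hXm i)
    have hm2 : Measurable fun ω => (Q.indicator 1 (countIn X T ω) : ℝ≥0∞) :=
      (Measurable.of_discrete (f := (Q.indicator 1 : ℕ∞ → ℝ≥0∞))).comp (measurable_countIn hXm hT)
    rw [← lintegral_const_mul (f := fun ω => T.indicator 1 (X i ω) *
      (Q.indicator 1 (countIn X T ω) * expNeg (∑' j, f (X j ω)))) _ (hm1.mul (hm2.mul
      (measurable_expNeg.comp (measurable_tsum_comp hXm hf))))]
    refine lintegral_congr fun ω => ?_
    by_cases hω : X i ω ∈ T
    · by_cases hQ : countIn X T ω ∈ Q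
      · have hcond := hnet.measure_cache_and_tsum_le_gain l i d
          (ζ := fun j => stationCost l w B (X j ω))
          (fun j => hcost.comp (measurable_const.prodMk measurable_id))
          (fun m => by simp [stationCost, hwT _ hω, hTB _ hω])
          (f := fun j => f (X j ω))
          (fun j => by rw [hfe, hnet.lintegral_expNeg_stationCost l j (hwfin _)])
          (hfT _ hω)
        rw [indicator_of_mem hω, indicator_of_mem hQ]
        simp only [Pi.one_apply, one_mul]
        rw [mul_assoc, ← hcond]
        congr 1
        ext ω'
        exact ⟨fun H => ⟨H.2.2.1, H.2.2.2⟩, fun H => ⟨hω, hQ, H.1, H.2⟩⟩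
      · rw [indicator_of_notMem hQ, zero_mul, mul_zero, mul_zero]
        exact (congrArg μ (eq_empty_of_forall_notMem fun ω' H => hQ H.2.1)).trans measure_empty
    · rw [indicator_of_notMem hω, zero_mul, mul_zero]
      exact (congrArg μ (eq_empty_of_forall_notMem fun ω' H => hω H.1)).trans measure_empty
  simp_rw [hi]
  rw [ENNReal.tsum_mul_left]
  congr 1
  rw [← lintegral_tsum]
  · have hψ : ∫⁻ ω, countWeight Q (countIn X T ω) ∂μ ≠ ∞ := by
      refine ne_top_of_le_ne_top ?_ (lintegral_mono fun ω => indicator_le_self Q _ (countIn X T ω))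
      rw [hnet.poisson.lintegral_countIn_eq hlam hT hTfin]
      exact ENNReal.mul_ne_top ENNReal.ofReal_ne_top hTfin
    have hlap := hnet.poisson.lintegral_countIn_mul_expNeg hlam hf hT hfT (countWeight Q) hψ
    simp_rw [hfe] at hlap
    rw [← hlap]
    refine lintegral_congr fun ω => ?_
    rw [ENNReal.tsum_mul_right, ← mul_assoc]
    congr 1
    have := tsum_indicator_eq_mul_countIn X T 1 ω
    rw [one_mul] at this
    rw [show (1 : Plane → ℝ≥0∞) = fun _ => 1 from rfl, this, countWeight]
    by_cases hQ : countIn X T ω ∈ Q <;> simp [hQ]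
  · intro i
    exact (((measurable_one.indicator hT).comp (hXm i)).mul
      (((Measurable.of_discrete (f := (Q.indicator 1 : ℕ∞ → ℝ≥0∞))).comp
        (measurable_countIn hXm hT)).mul
      (measurable_expNeg.comp (measurable_tsum_comp hXm hf)))).aemeasurable

end Shell

/-! ### The constants and the polar integral -/

section Constants

variable {α lam s x : ℝ}

lemma threshold_pos {W R₀ : ℝ} (hW : 0 < W) (hR₀ : 0 < R₀) : 0 < threshold W R₀ := by
  have := Real.one_lt_rpow (x := 2) (by norm_num) (div_pos hR₀ hW)
  unfold threshold
  linarith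

lemma integrableOn_rpow_div_one_add (hα : 2 < α) :
    IntegrableOn (fun u : ℝ => u ^ (2 / α - 1) / (1 + u)) (Ioi 0) := by
  have hα0 : 0 < α := by linarith
  have h1 : 2 / α < 1 := (div_lt_one hα0).2 hα
  have h0 : 0 < 2 / α := by positivity
  have hm : Measurable fun u : ℝ => u ^ (2 / α - 1) / (1 + u) := by fun_prop
  rw [← Ioc_union_Ioi_eq_Ioi zero_le_one]
  refine IntegrableOn.union ?_ ?_
  · have hi : IntegrableOn (fun u : ℝ => u ^ (2 / α - 1)) (Ioc 0 1) := by
      rw [integrableOn_Ioc_iff_integrableOn_Ioo, intervalIntegral.integrableOn_Ioo_rpow_iff one_pos]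
      linarith
    refine hi.mono' hm.aestronglyMeasurable
      (ae_restrict_of_forall_mem measurableSet_Ioc fun u hu => ?_)
    have hu0 : 0 < u := hu.1
    rw [Real.norm_of_nonneg (by positivity)]
    exact div_le_self (by positivity) (by linarith)
  · have hi : IntegrableOn (fun u : ℝ => u ^ (2 / α - 2)) (Ioi 1) :=
      integrableOn_Ioi_rpow_of_lt (by linarith) one_pos
    refine hi.mono' hm.aestronglyMeasurable
      (ae_restrict_of_forall_mem measurableSet_Ioi fun u hu => ?_)
    have hu0 : 0 < u := zero_lt_one.trans hu
    rw [Real.norm_of_nonneg (by positivity), show 2 / α - 2 = 2 / α - 1 - 1 by ring,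
      Real.rpow_sub_one hu0.ne' (2 / α - 1)]
    exact div_le_div_of_nonneg_left (by positivity) hu0 (by linarith)

lemma constA_nonneg (hlam : 0 < lam) (hα : 2 < α) (hs : 0 < s) : 0 ≤ constA α lam s := by
  unfold constA
  refine mul_nonneg (by positivity) (setIntegral_nonneg measurableSet_Ioi fun u hu => ?_)
  have : 0 < u := (one_div_pos.2 hs).trans hu
  positivity

lemma constB_pos (hlam : 0 < lam) (hα : 2 < α) (hs : 0 < s) : 0 < constB α lam s := by
  have hα0 : 0 < α := by linarith
  unfold constB
  refine mul_pos (by positivity) ?_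
  refine (setIntegral_pos_iff_support_of_nonneg_ae
    (ae_restrict_of_forall_mem measurableSet_Ioi fun u (hu : 0 < u) => ?_)
    (integrableOn_rpow_div_one_add hα)).2 ?_
  · show 0 ≤ u ^ (2 / α - 1) / (1 + u)
    positivity
  · refine lt_of_lt_of_le ?_ (measure_mono (s := Ioi 0) fun u (hu : 0 < u) => ⟨?_, hu⟩)
    · simp
    · exact (by positivity : 0 < u ^ (2 / α - 1) / (1 + u)).ne'

lemma constC_pos (hlam : 0 < lam) : 0 < constC lam := mul_pos Real.pi_pos hlam

lemma decayRate_pos (hlam : 0 < lam) (hα : 2 < α) (hs : 0 < s) (hx : x ∈ Icc (0 : ℝ) 1) :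
    0 < decayRate α lam s x := by
  have hA := constA_nonneg hlam hα hs
  have hB := constB_pos hlam hα hs
  have hC := constC_pos hlam
  obtain ⟨h0, h1⟩ := hx
  unfold decayRate
  rcases h0.eq_or_lt with rfl | h0
  · simpa using hB
  · have := mul_nonneg (sub_nonneg.2 h1) hB.le
    have := mul_nonneg h0.le hA
    have := mul_pos h0 hC
    linarith

lemma integrableOn_exp_decayRate (hlam : 0 < lam) (hα : 2 < α) (hs : 0 < s)
    (hx : x ∈ Icc (0 : ℝ) 1) :
    IntegrableOn (fun t : ℝ => Real.exp (-(decayRate α lam s x) * t)) (Ioi 0) :=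
  integrableOn_exp_mul_Ioi (neg_lt_zero.2 (decayRate_pos hlam hα hs hx)) 0

lemma g₀_eq (hlam : 0 < lam) (hα : 2 < α) (hs : 0 < s) (hx : x ∈ Icc (0 : ℝ) 1) :
    g₀ α lam s x = x * constC lam / decayRate α lam s x := by
  unfold g₀
  rw [integral_exp_mul_Ioi (neg_lt_zero.2 (decayRate_pos hlam hα hs hx)) 0]
  simp [div_eq_mul_inv]

/-- The substitution `u = (r / b) ^ α`. -/
lemma integral_div_one_add_rpow (hα : 2 < α) {b c : ℝ} (hb : 0 < b) (hc : 0 ≤ c) :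
    ∫ r in Ioi (b * c ^ α⁻¹), r * (1 + (r / b) ^ α)⁻¹ =
      b ^ 2 * (1 / α) * ∫ u in Ioi c, u ^ (2 / α - 1) / (1 + u) := by
  have hα0 : 0 < α := by linarith
  rw [← integral_comp_mul_left_Ioi' _ _ hb, ← integral_comp_rpow_Ioi_of_pos' hα0 hc, smul_eq_mul,
    ← integral_const_mul, ← integral_const_mul]
  refine setIntegral_congr_fun measurableSet_Ioi fun t ht => ?_
  have ht0 : 0 < t := lt_of_le_of_lt (by positivity) ht
  simp only [smul_eq_mul]
  rw [mul_div_cancel_left₀ _ hb.ne', ← Real.rpow_mul ht0.le,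
    show α * (2 / α - 1) = 2 - α by field_simp]
  have : t ^ (α - 1) * t ^ (2 - α) = t := by
    rw [← Real.rpow_add ht0]
    norm_num
  calc b * (b * t * (1 + t ^ α)⁻¹) = b ^ 2 * t / (1 + t ^ α) := by ring
    _ = b ^ 2 * (t ^ (α - 1) * t ^ (2 - α)) / (1 + t ^ α) := by rw [this]
    _ = _ := by field_simp

lemma integrableOn_div_one_add_rpow (hα : 2 < α) {b : ℝ} (hb : 0 < b) :
    IntegrableOn (fun r : ℝ => r * (1 + (r / b) ^ α)⁻¹) (Ioi 0) := by
  have hα0 : 0 < α := by linarith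
  have h1 := (integrableOn_Ioi_comp_rpow_iff' _ hα0.ne').2 (integrableOn_rpow_div_one_add hα)
  have h2 := (integrableOn_Ioi_comp_mul_left_iff (fun r : ℝ => r * (1 + (r / b) ^ α)⁻¹) 0 hb)
  rw [mul_zero] at h2
  rw [← h2]
  have h3 : IntegrableOn (fun t : ℝ => b * (t ^ (α - 1) • ((t ^ α) ^ (2 / α - 1) / (1 + t ^ α))))
      (Ioi 0) := h1.const_mul b
  refine h3.congr_fun (fun t ht => ?_) measurableSet_Ioi
  have ht0 : 0 < t := ht
  simp only [smul_eq_mul]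
  rw [mul_div_cancel_left₀ _ hb.ne', ← Real.rpow_mul ht0.le,
    show α * (2 / α - 1) = 2 - α by field_simp]
  have : t ^ (α - 1) * t ^ (2 - α) = t := by
    rw [← Real.rpow_add ht0]
    norm_num
  calc b * (t ^ (α - 1) * (t ^ (2 - α) / (1 + t ^ α))) =
      b * (t ^ (α - 1) * t ^ (2 - α)) / (1 + t ^ α) := by ring
    _ = _ := by rw [this, div_eq_mul_inv]

/-- The weight of a station at `y ≠ 0` when the serving station is at distance `a`: threshold times
path loss relative to the serving station. It vanishes at `y = 0`, as `receivedPower` does. -/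
noncomputable def pathWeight (α s a : ℝ) (y : Plane) : ℝ≥0∞ :=
  ENNReal.ofReal (s * a ^ α * ‖y‖ ^ (-α))

lemma measurable_pathWeight (α s a : ℝ) : Measurable (pathWeight α s a) := by
  unfold pathWeight
  fun_prop

lemma pathWeight_ne_top (α s a : ℝ) (y : Plane) : pathWeight α s a y ≠ ∞ := ENNReal.ofReal_ne_top

/-- The loss `1 - retention` in polar coordinates. -/
lemma one_sub_retention_pathWeight (hα : 2 < α) (hs : 0 < s) {a : ℝ} (ha : 0 < a)
    (hx : x ∈ Icc (0 : ℝ) 1) {y : Plane} (hy : y ≠ 0) :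
    1 - retention x (pathWeight α s a) (Metric.ball 0 a) y =
      ENNReal.ofReal ((1 - x) * (1 + (‖y‖ / (a * s ^ α⁻¹)) ^ α)⁻¹ +
        x * if ‖y‖ < a then 1 else (1 + (‖y‖ / (a * s ^ α⁻¹)) ^ α)⁻¹) := by
  have hα0 : 0 < α := by linarith
  have hr : 0 < ‖y‖ := norm_pos_iff.2 hy
  have hpow : (‖y‖ / (a * s ^ α⁻¹)) ^ α = (s * a ^ α * ‖y‖ ^ (-α))⁻¹ := by
    rw [Real.div_rpow hr.le (by positivity), Real.mul_rpow ha.le (by positivity),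
      Real.rpow_inv_rpow hs.le hα0.ne', Real.rpow_neg hr.le]
    field_simp
  rw [hpow]
  set v := s * a ^ α * ‖y‖ ^ (-α) with hv
  have hv0 : 0 < v := by positivity
  have hinv : (1 + pathWeight α s a y)⁻¹ = ENNReal.ofReal ((1 + v)⁻¹) := by
    rw [ENNReal.ofReal_inv_of_pos (by positivity), ENNReal.ofReal_add zero_le_one hv0.le,
      ENNReal.ofReal_one, pathWeight]
  have hloss : (1 + v⁻¹)⁻¹ = 1 - (1 + v)⁻¹ := by field_simp; ring
  unfold retention
  rw [hinv, Metric.mem_ball, dist_zero_right, ← ENNReal.ofReal_one]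
  obtain ⟨h0, h1⟩ := hx
  split_ifs with h
  · rw [← ENNReal.ofReal_mul (by positivity), ← ENNReal.ofReal_sub _
      (mul_nonneg (by positivity) (by linarith)), hloss]
    congr 1
    ring
  · rw [← ENNReal.ofReal_mul (by positivity), ← ENNReal.ofReal_sub _ (by positivity), hloss]
    congr 1
    ring

/-- The exponent of the Laplace functional is the decay rate times the squared distance of the
serving station. -/
theorem lintegral_one_sub_retention (hlam : 0 < lam) (hα : 2 < α) (hs : 0 < s) {a : ℝ}
    (ha : 0 < a) (hx : x ∈ Icc (0 : ℝ) 1) :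
    ENNReal.ofReal lam * ∫⁻ y, (1 - retention x (pathWeight α s a) (Metric.ball 0 a) y) =
      ENNReal.ofReal (decayRate α lam s x * a ^ 2) := by
  have hα0 : 0 < α := by linarith
  set b := a * s ^ α⁻¹ with hb
  have hb0 : 0 < b := by positivity
  let k : ℝ → ℝ := fun r => (1 + (r / b) ^ α)⁻¹
  let k' : ℝ → ℝ := fun r => if r < a then 1 else k r
  let g : ℝ → ℝ := fun r => (1 - x) * k r + x * k' r
  have hk : IntegrableOn (fun r => r * k r) (Ioi 0) := integrableOn_div_one_add_rpow hα hb0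
  have hk1 : IntegrableOn (fun r => r * k' r) (Ioo 0 a) := by
    refine (((continuous_id : Continuous fun r : ℝ => r).integrableOn_Icc
      (a := 0) (b := a)).mono_set Ioo_subset_Icc_self).congr_fun (fun r hr => ?_) measurableSet_Ioo
    simp [k', hr.2]
  have hk2 : IntegrableOn (fun r => r * k' r) (Ici a) := by
    refine (hk.mono_set (Ici_subset_Ioi.2 ha)).congr_fun (fun r hr => ?_) measurableSet_Ici
    simp [k', not_lt.2 (mem_Ici.1 hr)]
  have hk' : IntegrableOn (fun r => r * k' r) (Ioi 0) := by
    rw [← Ioo_union_Ici_eq_Ioi ha]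
    exact hk1.union hk2
  have hsplit : ∀ r, r ^ (Module.finrank ℝ Plane - 1) • g r =
      (1 - x) * (r * k r) + x * (r * k' r) := fun r => by
    simp [g]
    ring
  have hint : Integrable fun y : Plane => g ‖y‖ := by
    rw [integrable_fun_norm_addHaar]
    simp_rw [hsplit]
    exact (hk.const_mul _).add (hk'.const_mul _)
  have hI1 : ∫ r in Ioi 0, r * k r = b ^ 2 * (1 / α) * ∫ u in Ioi 0, u ^ (2 / α - 1) / (1 + u) := by
    have := integral_div_one_add_rpow hα hb0 (le_refl 0)
    rwa [Real.zero_rpow (inv_ne_zero hα0.ne'), mul_zero] at this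
  have hI2 : ∫ r in Ici a, r * k' r =
      b ^ 2 * (1 / α) * ∫ u in Ioi (1 / s), u ^ (2 / α - 1) / (1 + u) := by
    have := integral_div_one_add_rpow hα hb0 (one_div_pos.2 hs).le
    rw [show b * (1 / s) ^ α⁻¹ = a by
      rw [hb, Real.div_rpow zero_le_one hs.le, Real.one_rpow]; field_simp] at this
    rw [← this, ← integral_Ici_eq_integral_Ioi]
    refine setIntegral_congr_fun measurableSet_Ici fun r hr => ?_
    simp [k', k, not_lt.2 (mem_Ici.1 hr)]
  have hI3 : ∫ r in Ioo 0 a, r * k' r = a ^ 2 / 2 := by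
    have : ∫ r in Ioo 0 a, r * k' r = ∫ r in Ioo 0 a, r :=
      setIntegral_congr_fun measurableSet_Ioo fun r hr => by simp [k', hr.2]
    rw [this, ← integral_Ioc_eq_integral_Ioo, ← intervalIntegral.integral_of_le ha.le, integral_id]
    ring
  have hval : lam * ∫ y : Plane, g ‖y‖ = decayRate α lam s x * a ^ 2 := by
    rw [integral_fun_norm_addHaar]
    simp_rw [hsplit]
    rw [integral_add (hk.const_mul _) (hk'.const_mul _), integral_const_mul, integral_const_mul,
      hI1, ← Ioo_union_Ici_eq_Ioi ha, setIntegral_union _ measurableSet_Ici hk1 hk2, hI2, hI3]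
    · have hvol : (volume : Measure Plane).real (Metric.ball 0 1) = Real.pi := by
        rw [measureReal_def, EuclideanSpace.volume_ball_fin_two]
        simp [Real.pi_nonneg]
      have hb2 : b ^ 2 = a ^ 2 * s ^ (2 / α) := by
        rw [hb, mul_pow, ← Real.rpow_natCast (s ^ α⁻¹) 2, ← Real.rpow_mul hs.le]
        congr 2
        push_cast
        field_simp
      rw [hvol, hb2, decayRate, constA, constB, constC, finrank_euclideanSpace, Fintype.card_fin]
      simp only [nsmul_eq_mul, smul_eq_mul, Nat.cast_ofNat, Ioo_union_Ici_eq_Ioi ha]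
      ring
    · exact Set.disjoint_left.2 fun r hr hr' => not_lt.2 hr' hr.2
  have hg0 : ∀ y : Plane, 0 ≤ g ‖y‖ := fun y => by
    obtain ⟨h0, h1⟩ := hx
    have hk0 : 0 ≤ k ‖y‖ := by positivity
    have hk0' : 0 ≤ k' ‖y‖ := by
      simp only [k']
      split_ifs
      · exact zero_le_one
      · exact hk0
    exact add_nonneg (mul_nonneg (by linarith) hk0) (mul_nonneg h0 hk0')
  have hae : ∀ᵐ y : Plane, 1 - retention x (pathWeight α s a) (Metric.ball 0 a) y =
      ENNReal.ofReal (g ‖y‖) := by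
    filter_upwards [compl_mem_ae_iff.2 (measure_singleton (0 : Plane))] with y hy
    exact one_sub_retention_pathWeight hα hs ha hx hy
  rw [lintegral_congr_ae hae, ← ofReal_integral_eq_lintegral_ofReal hint
    (Filter.Eventually.of_forall hg0), ← ENNReal.ofReal_mul hlam.le, hval]

end Constants

/-! ### Shells around the user -/

/-- The half-open shell `a ≤ ‖y‖ < b`. -/
def shell (a b : ℝ) : Set Plane := Metric.ball 0 b \ Metric.ball 0 a

lemma mem_shell {a b : ℝ} {y : Plane} : y ∈ shell a b ↔ a ≤ ‖y‖ ∧ ‖y‖ < b := by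
  simp [shell, and_comm]

lemma measurableSet_shell (a b : ℝ) : MeasurableSet (shell a b) :=
  measurableSet_ball.diff measurableSet_ball

lemma volume_shell {a b : ℝ} (ha : 0 ≤ a) (hab : a ≤ b) :
    volume (shell a b) = ENNReal.ofReal (Real.pi * (b ^ 2 - a ^ 2)) := by
  rw [shell, measure_sdiff (Metric.ball_subset_ball hab) measurableSet_ball.nullMeasurableSet
    measure_ball_lt_top.ne, EuclideanSpace.volume_ball_fin_two, EuclideanSpace.volume_ball_fin_two,
    ← ENNReal.ofReal_pow ha, ← ENNReal.ofReal_pow (ha.trans hab),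
    ← ENNReal.ofReal_mul (by positivity), ← ENNReal.ofReal_mul (by positivity),
    ← ENNReal.ofReal_sub _ (by positivity)]
  congr 1
  ring

section Exponents

variable {α lam s x a b : ℝ}

lemma retention_anti (hx : x ∈ Icc (0 : ℝ) 1) {w w' : Plane → ℝ≥0∞} {B B' : Set Plane} {y : Plane}
    (hw : w y ≤ w' y) (hB : B ⊆ B') : retention x w' B' y ≤ retention x w B y := by
  have h1 : ENNReal.ofReal (1 - x) ≤ 1 := by
    rw [ENNReal.ofReal_le_one]; linarith [hx.1]
  unfold retention
  refine mul_le_mul' (ENNReal.inv_le_inv.2 (add_le_add_right hw 1)) ?_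
  by_cases hy : y ∈ B
  · simp [hy, hB hy]
  · by_cases hy' : y ∈ B' <;> simp [hy, hy', h1]

/-- Sparing the shell of the serving station from the interference costs at most the mean number
of stations in it. -/
lemma decayRate_le_lintegral_shell (hlam : 0 < lam) (hα : 2 < α) (hs : 0 < s) (ha : 0 ≤ a)
    (hab : a ≤ b) (hx : x ∈ Icc (0 : ℝ) 1) :
    ENNReal.ofReal (decayRate α lam s x * a ^ 2) ≤
      ENNReal.ofReal lam * (∫⁻ y, (1 - retention x ((shell a b)ᶜ.indicator (pathWeight α s a))
        (Metric.ball 0 a) y)) + ENNReal.ofReal (constC lam * (b ^ 2 - a ^ 2)) := by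
  rcases ha.eq_or_lt with rfl | ha
  · simp
  have hC : ENNReal.ofReal (constC lam * (b ^ 2 - a ^ 2)) =
      ENNReal.ofReal lam * volume (shell a b) := by
    rw [volume_shell ha.le hab, ← ENNReal.ofReal_mul hlam.le, constC]
    congr 1
    ring
  rw [← lintegral_one_sub_retention hlam hα hs ha hx, hC, ← mul_add,
    ← lintegral_indicator_one (measurableSet_shell a b),
    ← lintegral_add_right _ (measurable_one.indicator (measurableSet_shell a b))]
  gcongr with y
  by_cases hy : y ∈ shell a b
  · rw [indicator_of_mem hy, Pi.one_apply]
    exact tsub_le_self.trans le_add_self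
  · simp [hy, retention]

lemma lintegral_shell_le_decayRate (hlam : 0 < lam) (hα : 2 < α) (hs : 0 < s) (ha : 0 ≤ a)
    (hab : a < b) (hx : x ∈ Icc (0 : ℝ) 1) :
    ENNReal.ofReal lam * (∫⁻ y, (1 - retention x ((shell a b)ᶜ.indicator (pathWeight α s b))
        (Metric.ball 0 a) y)) ≤ ENNReal.ofReal (decayRate α lam s x * b ^ 2) := by
  rw [← lintegral_one_sub_retention hlam hα hs (ha.trans_lt hab) hx]
  gcongr with y
  exact retention_anti hx (indicator_le_self _ _ y) (Metric.ball_subset_ball hab.le)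

end Exponents

/-! ### Success of a request in terms of station costs -/

section Events

variable {Ω : Type*} {N : ℕ} {α W R₀ P noise a b : ℝ} {X : ℕ → Ω → Plane} {h : ℕ → Ω → ℝ}
  {cache : ℕ → Ω → Set (Fin N)} {l : Fin N} {i : ℕ} {ω : Ω}

lemma rate_iff (hW : 0 < W) :
    R₀ ≤ W * Real.logb 2 (1 + sinr α P noise X h i ω) ↔
      threshold W R₀ ≤ sinr α P noise X h i ω := by
  have h0 : 0 ≤ sinr α P noise X h i ω := ENNReal.toReal_nonneg
  rw [← div_le_iff₀' hW, Real.le_logb_iff_rpow_le (by norm_num) (by linarith), threshold,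
    sub_le_iff_le_add']

lemma receivedPower_eq (hP : 0 < P) (j : ℕ) :
    receivedPower α P X h j ω = ENNReal.ofReal (h j ω) * ENNReal.ofReal (P * ‖X j ω‖ ^ (-α)) := by
  rw [receivedPower, mul_assoc, ENNReal.ofReal_mul' (by positivity)]

lemma interference_eq :
    interference α P X h i ω = ∑' j, {j | j ≠ i}.indicator (fun j => receivedPower α P X h j ω) j :=
  tsum_subtype {j | j ≠ i} fun j => receivedPower α P X h j ω

/-- Power at the user, rescaled by the path loss of a link of length `r`. -/
lemma ofReal_mul_receivedPower (hP : 0 < P) {s r : ℝ} (hs : 0 ≤ s) (hr : 0 < r) (j : ℕ) :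
    ENNReal.ofReal (r ^ α / P) * (ENNReal.ofReal s * receivedPower α P X h j ω) =
      ENNReal.ofReal (h j ω) * pathWeight α s r (X j ω) := by
  rw [receivedPower_eq hP, pathWeight, mul_left_comm (ENNReal.ofReal s), mul_left_comm,
    ← ENNReal.ofReal_mul hs, ← ENNReal.ofReal_mul (by positivity)]
  congr 2
  field_simp

lemma ofReal_mul_receivedPower_self (hP : 0 < P) (hXi : X i ω ≠ 0) :
    ENNReal.ofReal (‖X i ω‖ ^ α / P) * receivedPower α P X h i ω = ENNReal.ofReal (h i ω) := by
  have hr : 0 < ‖X i ω‖ := norm_pos_iff.2 hXi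
  rw [receivedPower_eq hP, mul_left_comm, ← ENNReal.ofReal_mul (by positivity),
    Real.rpow_neg hr.le]
  have : ‖X i ω‖ ^ α / P * (P * (‖X i ω‖ ^ α)⁻¹) = 1 := by
    have : 0 < ‖X i ω‖ ^ α := by positivity
    field_simp
  rw [this, ENNReal.ofReal_one, mul_one]

lemma pathWeight_mono (hα : 2 < α) {s r r' : ℝ} (hs : 0 ≤ s) (hr : 0 ≤ r) (hrr' : r ≤ r')
    (y : Plane) : pathWeight α s r y ≤ pathWeight α s r' y := by
  unfold pathWeight
  gcongr

/-- A successful request served from within the shell forces the gain to exceed the cost of the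
stations outside the shell, measured from its inner radius. -/
lemma cost_le_of_success (hα : 2 < α) (hW : 0 < W) (hR₀ : 0 < R₀) (hP : 0 < P) (ha : 0 ≤ a)
    (hXi : X i ω ∈ shell a b) (hserve : Serves X cache l i ω)
    (hrate : R₀ ≤ W * Real.logb 2 (1 + sinr α P noise X h i ω)) :
    ∑' j, stationCost l ((shell a b)ᶜ.indicator (pathWeight α (threshold W R₀) a))
      (Metric.ball 0 a) (X j ω) (h j ω, cache j ω) ≤ ENNReal.ofReal (h i ω) := by
  have hs := threshold_pos hW hR₀
  rw [rate_iff hW, sinr] at hrate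
  set s := threshold W R₀
  have hle := ENNReal.mul_le_of_le_div (ENNReal.ofReal_le_of_le_toReal hrate)
  -- a station at the origin has received power `0`, as `0 ^ (-α) = 0`
  have hXi0 : X i ω ≠ 0 := by
    intro h0
    have : receivedPower α P X h i ω = 0 := by
      simp [receivedPower, h0, Real.zero_rpow (show -α ≠ 0 by linarith)]
    rw [this] at hrate
    simp at hrate
    linarith
  have hr : 0 < ‖X i ω‖ := norm_pos_iff.2 hXi0
  obtain ⟨hai, -⟩ := mem_shell.1 hXi
  have hcost : ∀ j, stationCost l ((shell a b)ᶜ.indicator (pathWeight α s a))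
      (Metric.ball 0 a) (X j ω) (h j ω, cache j ω) ≤ ENNReal.ofReal (‖X i ω‖ ^ α / P) *
        (ENNReal.ofReal s * {j | j ≠ i}.indicator (fun j => receivedPower α P X h j ω) j) := by
    intro j
    have hnear : ¬ (X j ω ∈ Metric.ball 0 a ∧ l ∈ cache j ω) := by
      rintro ⟨hj, hl⟩
      have h1 := hserve.2 j hl
      have h2 : ‖X j ω‖ < a := by simpa using hj
      linarith
    rcases eq_or_ne j i with rfl | hji
    · rw [stationCost, if_neg hnear]
      simp [hXi]
    · rw [indicator_of_mem (show j ∈ {j | j ≠ i} from hji), ofReal_mul_receivedPower hP hs.le hr]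
      simp only [stationCost, if_neg hnear, add_zero]
      gcongr
      exact (indicator_le_self _ _ _).trans (pathWeight_mono hα hs.le ha hai _)
  calc _ ≤ ∑' j, ENNReal.ofReal (‖X i ω‖ ^ α / P) *
        (ENNReal.ofReal s * {j | j ≠ i}.indicator (fun j => receivedPower α P X h j ω) j) :=
        ENNReal.tsum_le_tsum hcost
    _ = ENNReal.ofReal (‖X i ω‖ ^ α / P) * (ENNReal.ofReal s * interference α P X h i ω) := by
        rw [ENNReal.tsum_mul_left, ENNReal.tsum_mul_left, ← interference_eq]
    _ ≤ ENNReal.ofReal (‖X i ω‖ ^ α / P) * receivedPower α P X h i ω := by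
        gcongr
        exact le_trans (by gcongr; exact le_self_add) hle
    _ = _ := ofReal_mul_receivedPower_self hP hXi0

/-- If the shell holds a single station and its gain exceeds the cost of all others, then that
station serves the request. -/
lemma serves_of_cost_le {w : Plane → ℝ≥0∞}
    (hXi : X i ω ∈ shell a b) (hone : countIn X (shell a b) ω = 1) (hl : l ∈ cache i ω)
    {d : ℝ≥0∞} (hcost : ∑' j, stationCost l w (Metric.ball 0 a) (X j ω) (h j ω, cache j ω) + d ≤
      ENNReal.ofReal (h i ω)) :
    Serves X cache l i ω := by
  refine ⟨hl, fun j hj => ?_⟩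
  obtain ⟨hai, hib⟩ := mem_shell.1 hXi
  have hnear : X j ω ∉ Metric.ball 0 a := fun hjB => by
    have h1 : stationCost l w (Metric.ball 0 a) (X j ω) (h j ω, cache j ω) = ⊤ := by
      simp only [stationCost, if_pos (And.intro hjB hj), add_top]
    have h2 := (ENNReal.le_tsum j).trans (le_self_add.trans hcost)
    rw [h1, top_le_iff] at h2
    exact ENNReal.ofReal_ne_top h2
  by_cases hjT : X j ω ∈ shell a b
  · obtain ⟨k, hk⟩ := encard_eq_one.1 hone
    have hik : i ∈ ({k} : Set ℕ) := hk ▸ hXi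
    have hjk : j ∈ ({k} : Set ℕ) := hk ▸ hjT
    rw [mem_singleton_iff.1 hik, mem_singleton_iff.1 hjk]
  · have h1 : a ≤ ‖X j ω‖ := by simpa using hnear
    have h2 : b ≤ ‖X j ω‖ := not_lt.1 fun h' => hjT (mem_shell.2 ⟨h1, h'⟩)
    linarith

/-- Under the same condition, with the cost measured from the outer radius and enlarged by the
noise, the request succeeds. The interference must not vanish, since without noise `sinr` would then
be `∞` turned into `0`. -/
lemma rate_of_cost_le (hα : 2 < α) (hW : 0 < W) (hR₀ : 0 < R₀) (hP : 0 < P)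
    (hnoise : 0 ≤ noise) (hXi : X i ω ∈ shell a b) (hXi0 : X i ω ≠ 0)
    (hI : interference α P X h i ω ≠ 0) (hone : countIn X (shell a b) ω = 1)
    (hcost : ∑' j, stationCost l ((shell a b)ᶜ.indicator (pathWeight α (threshold W R₀) b))
      (Metric.ball 0 a) (X j ω) (h j ω, cache j ω) +
        ENNReal.ofReal (threshold W R₀ * b ^ α * (noise / P)) ≤ ENNReal.ofReal (h i ω)) :
    R₀ ≤ W * Real.logb 2 (1 + sinr α P noise X h i ω) := by
  have hs := threshold_pos hW hR₀
  rw [rate_iff hW, sinr]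
  set s := threshold W R₀
  have hr : 0 < ‖X i ω‖ := norm_pos_iff.2 hXi0
  obtain ⟨-, hib⟩ := mem_shell.1 hXi
  have hM0 : ENNReal.ofReal (‖X i ω‖ ^ α / P) ≠ 0 :=
    (ENNReal.ofReal_pos.2 (by positivity)).ne'
  have hterm : ∀ j, ENNReal.ofReal (‖X i ω‖ ^ α / P) *
        (ENNReal.ofReal s * {j | j ≠ i}.indicator (fun j => receivedPower α P X h j ω) j) ≤
      stationCost l ((shell a b)ᶜ.indicator (pathWeight α s b))
        (Metric.ball 0 a) (X j ω) (h j ω, cache j ω) := by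
    intro j
    rcases eq_or_ne j i with rfl | hji
    · simp
    · have hjT : X j ω ∉ shell a b := fun hjT => by
        obtain ⟨k, hk⟩ := encard_eq_one.1 hone
        have hik : i ∈ ({k} : Set ℕ) := hk ▸ hXi
        have hjk : j ∈ ({k} : Set ℕ) := hk ▸ hjT
        exact hji (by rw [mem_singleton_iff.1 hik, mem_singleton_iff.1 hjk])
      rw [indicator_of_mem (show j ∈ {j | j ≠ i} from hji), ofReal_mul_receivedPower hP hs.le hr,
        stationCost, indicator_of_mem (mem_compl hjT)]
      refine le_trans ?_ le_self_add
      gcongr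
      exact pathWeight_mono hα hs.le hr.le hib.le _
  have hnoise' : ENNReal.ofReal (‖X i ω‖ ^ α / P) * (ENNReal.ofReal s * ENNReal.ofReal noise) ≤
      ENNReal.ofReal (s * b ^ α * (noise / P)) := by
    rw [← ENNReal.ofReal_mul hs.le, ← ENNReal.ofReal_mul (by positivity)]
    refine ENNReal.ofReal_le_ofReal ?_
    calc ‖X i ω‖ ^ α / P * (s * noise) = s * ‖X i ω‖ ^ α * (noise / P) := by ring
      _ ≤ _ := by gcongr
  have hle : ENNReal.ofReal s * (interference α P X h i ω + ENNReal.ofReal noise) ≤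
      receivedPower α P X h i ω := by
    rw [← ENNReal.mul_le_mul_iff_right hM0 ENNReal.ofReal_ne_top,
      ofReal_mul_receivedPower_self hP hXi0]
    refine le_trans ?_ hcost
    rw [mul_add, mul_add, interference_eq, ← ENNReal.tsum_mul_left, ← ENNReal.tsum_mul_left]
    exact add_le_add (ENNReal.tsum_le_tsum hterm) hnoise'
  have hrp : receivedPower α P X h i ω ≠ ⊤ := ENNReal.ofReal_ne_top
  have hne0 : interference α P X h i ω + ENNReal.ofReal noise ≠ 0 := fun h0 =>
    hI (add_eq_zero.1 h0).1
  have hnetop : interference α P X h i ω + ENNReal.ofReal noise ≠ ⊤ := fun h0 => by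
    rw [h0, ENNReal.mul_top (ENNReal.ofReal_pos.2 hs).ne', top_le_iff] at hle
    exact hrp hle
  rw [← ENNReal.ofReal_le_iff_le_toReal (ENNReal.div_ne_top hrp hne0),
    ENNReal.le_div_iff_mul_le (Or.inl hne0) (Or.inl hnetop)]
  exact hle

end Events

/-- The radii `√(k / n)`, whose shells all have area `π / n` and partition the plane. -/
noncomputable def radius (n k : ℕ) : ℝ := √(k / n)

lemma radius_sq (n k : ℕ) : radius n k ^ 2 = k / n := Real.sq_sqrt (by positivity)

lemma radius_nonneg (n k : ℕ) : 0 ≤ radius n k := Real.sqrt_nonneg _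

lemma radius_lt_succ {n : ℕ} (hn : 0 < n) (k : ℕ) : radius n k < radius n (k + 1) := by
  have : (0 : ℝ) < n := by exact_mod_cast hn
  refine Real.sqrt_lt_sqrt (by positivity) ?_
  push_cast
  gcongr
  linarith

lemma radius_succ_sq_sub (n k : ℕ) : radius n (k + 1) ^ 2 - radius n k ^ 2 = 1 / n := by
  rw [radius_sq, radius_sq]
  push_cast
  ring

lemma mem_shell_radius_iff {n : ℕ} (hn : 0 < n) {k : ℕ} {y : Plane} :
    y ∈ shell (radius n k) (radius n (k + 1)) ↔ ⌊n * ‖y‖ ^ 2⌋₊ = k := by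
  have hn' : (0 : ℝ) < n := by exact_mod_cast hn
  rw [mem_shell, Nat.floor_eq_iff (by positivity), ← div_le_iff₀' hn', ← lt_div_iff₀' hn',
    radius, radius, Real.sqrt_le_left (norm_nonneg y), Real.lt_sqrt (norm_nonneg y)]
  push_cast
  rfl

/-! ### Two-sided bounds on the success probability -/

/-- The event that station `i` lies in the shell `[a, b)`, that the number of stations there is in
`Q`, and that station `i` caches `l` with a gain exceeding the cost of the stations outside the
shell, measured from radius `r`, plus `d`. -/
def shellEvent {Ω : Type*} {N : ℕ} (X : ℕ → Ω → Plane) (h : ℕ → Ω → ℝ)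
    (cache : ℕ → Ω → Set (Fin N)) (l : Fin N) (α s r a b : ℝ) (d : ℝ≥0∞) (Q : Set ℕ∞) (i : ℕ) :
    Set Ω :=
  {ω | X i ω ∈ shell a b ∧ countIn X (shell a b) ω ∈ Q ∧ l ∈ cache i ω ∧
    ∑' j, stationCost l ((shell a b)ᶜ.indicator (pathWeight α s r)) (Metric.ball 0 a) (X j ω)
      (h j ω, cache j ω) + d ≤ ENNReal.ofReal (h i ω)}

section Bounds

variable {Ω : Type*} [MeasurableSpace Ω] {μ : Measure Ω} [IsProbabilityMeasure μ] {N L : ℕ}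
  {lam α W R₀ P noise a b : ℝ} {q : Fin N → ℝ}
  {X : ℕ → Ω → Plane} {h : ℕ → Ω → ℝ} {cache : ℕ → Ω → Set (Fin N)}
  (hnet : IsNetwork μ lam L q X h cache)
include hnet

omit [IsProbabilityMeasure μ] in
lemma IsNetwork.ae_gain_pos : ∀ᵐ ω ∂μ, ∀ j, 0 < h j ω := by
  have := isProbabilityMeasure_expMeasure one_pos
  refine ae_all_iff.2 fun j => ?_
  have h0 : expMeasure 1 (Iic 0) = 0 := by
    rw [← ofReal_cdf, cdf_expMeasure_eq one_pos]
    simp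
  have h1 : μ (h j ⁻¹' Iic 0) = 0 := by
    rw [← Measure.map_apply (hnet.measurable_gain j) measurableSet_Iic,
      (hnet.hasLaw_gain j).map_eq, h0]
  filter_upwards [compl_mem_ae_iff.2 h1] with ω hω
  simpa using hω

omit [IsProbabilityMeasure μ] in
lemma IsNetwork.ae_pos_ne_zero (hlam : 0 < lam) : ∀ᵐ ω ∂μ, ∀ j, X j ω ≠ 0 := by
  have hm := measurableSet_singleton (0 : Plane)
  have h0 := hnet.poisson.lintegral_countIn_eq hlam hm (by simp)
  have hc : Measurable fun ω => (countIn X {0} ω : ℝ≥0∞) :=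
    Measurable.of_discrete.comp (measurable_countIn hnet.poisson.measurable_pos hm)
  rw [measure_singleton, mul_zero, lintegral_eq_zero_iff hc] at h0
  filter_upwards [h0] with ω hω j hj
  have h1 : countIn X {0} ω = 0 := by simpa using hω
  have h2 : {i | X i ω ∈ ({0} : Set Plane)} = ∅ := encard_eq_zero.1 h1
  have : j ∈ {i | X i ω ∈ ({0} : Set Plane)} := hj
  rw [h2] at this
  exact this

omit [IsProbabilityMeasure μ] in
lemma IsNetwork.ae_interference_ne_zero (hlam : 0 < lam) (hP : 0 < P) :
    ∀ᵐ ω ∂μ, ∀ i, interference α P X h i ω ≠ 0 := by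
  filter_upwards [hnet.ae_gain_pos, hnet.ae_pos_ne_zero hlam] with ω hh hX i
  have hr : 0 < ‖X (i + 1) ω‖ := norm_pos_iff.2 (hX _)
  have hpos : 0 < receivedPower α P X h (i + 1) ω := by
    have := hh (i + 1)
    exact ENNReal.ofReal_pos.2 (by positivity)
  have hle : receivedPower α P X h (i + 1) ω ≤ interference α P X h i ω :=
    ENNReal.le_tsum (f := fun j : {j // j ≠ i} => receivedPower α P X h j ω)
      ⟨i + 1, Nat.succ_ne_self i⟩
  exact (hpos.trans_le hle).ne'

omit [IsProbabilityMeasure μ] in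
lemma IsNetwork.measurableSet_shellEvent (l : Fin N) (α s r a b : ℝ) (d : ℝ≥0∞) (Q : Set ℕ∞)
    (i : ℕ) : MeasurableSet (shellEvent X h cache l α s r a b d Q i) := by
  have hXm := hnet.poisson.measurable_pos
  have hT := measurableSet_shell a b
  have hw : Measurable ((shell a b)ᶜ.indicator (pathWeight α s r)) :=
    (measurable_pathWeight α s r).indicator hT.compl
  have h4 : MeasurableSet {ω | ∑' j, stationCost l ((shell a b)ᶜ.indicator (pathWeight α s r))
      (Metric.ball 0 a) (X j ω) (h j ω, cache j ω) + d ≤ ENNReal.ofReal (h i ω)} :=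
    measurableSet_le ((Measurable.tsum fun j => (measurable_stationCost l hw
      measurableSet_ball).comp ((hXm j).prodMk (hnet.measurable_mark j))).add_const d)
      (hnet.measurable_gain i).ennreal_ofReal
  exact (hXm i hT).inter ((measurable_countIn hXm hT (MeasurableSet.of_discrete (s := Q))).inter
    ((hnet.measurableSet_cache i l).inter h4))

lemma IsNetwork.tsum_measure_shellEvent (hlam : 0 < lam) (l : Fin N) (α s r : ℝ)
    (ha : 0 ≤ a) (hab : a ≤ b) (d : ℝ≥0∞) (Q : Set ℕ∞) :
    ∑' i, μ (shellEvent X h cache l α s r a b d Q i) =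
      ENNReal.ofReal (q l) * expNeg d *
        ((∫⁻ ω, countWeight Q (countIn X (shell a b) ω) ∂μ) *
        expNeg (ENNReal.ofReal lam * ∫⁻ y, (1 - retention (q l)
          ((shell a b)ᶜ.indicator (pathWeight α s r)) (Metric.ball 0 a) y))) := by
  refine hnet.tsum_measure_shell hlam l
    ((measurable_pathWeight α s r).indicator (measurableSet_shell a b).compl) (fun y => ?_)
    measurableSet_ball (measurableSet_shell a b) ?_ disjoint_sdiff_right (fun y hy => ?_) d Q
  · exact ne_top_of_le_ne_top (pathWeight_ne_top α s r y) (indicator_le_self _ _ y)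
  · rw [volume_shell ha hab]
    exact ENNReal.ofReal_ne_top
  · simp [hy]

/-- Expected number of stations in a shell whose gain exceeds the cost measured from the inner
radius. -/
lemma IsNetwork.tsum_measure_shellEvent_le (hlam : 0 < lam) (hα : 2 < α) {s : ℝ} (hs : 0 < s)
    (l : Fin N) (ha : 0 ≤ a) (hab : a ≤ b) :
    ∑' i, μ (shellEvent X h cache l α s a a b 0 univ i) ≤
      ENNReal.ofReal (q l * (constC lam * (b ^ 2 - a ^ 2)) *
        Real.exp (constC lam * (b ^ 2 - a ^ 2)) *
        Real.exp (-(decayRate α lam s (q l) * a ^ 2))) := by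
  have hx : q l ∈ Icc (0 : ℝ) 1 := ⟨hnet.q_nonneg l, hnet.q_le_one l⟩
  have hc : 0 ≤ constC lam * (b ^ 2 - a ^ 2) :=
    mul_nonneg (constC_pos hlam).le (sub_nonneg.2 (pow_le_pow_left₀ ha hab 2))
  have hD : 0 ≤ decayRate α lam s (q l) * a ^ 2 :=
    mul_nonneg (decayRate_pos hlam hα hs hx).le (by positivity)
  rw [hnet.tsum_measure_shellEvent hlam l α s a ha hab]
  have hmean : ∫⁻ ω, countWeight univ (countIn X (shell a b) ω) ∂μ =
      ENNReal.ofReal (constC lam * (b ^ 2 - a ^ 2)) := by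
    simp only [countWeight, indicator_univ]
    rw [hnet.poisson.lintegral_countIn_eq hlam (measurableSet_shell a b)
      (by rw [volume_shell ha hab]; exact ENNReal.ofReal_ne_top), volume_shell ha hab,
      ← ENNReal.ofReal_mul hlam.le, constC]
    congr 1
    ring
  set J := ENNReal.ofReal lam * ∫⁻ y, (1 - retention (q l)
          ((shell a b)ᶜ.indicator (pathWeight α s a)) (Metric.ball 0 a) y) with hJ
  have hJle : expNeg J ≤ ENNReal.ofReal (Real.exp (constC lam * (b ^ 2 - a ^ 2)) *
      Real.exp (-(decayRate α lam s (q l) * a ^ 2))) := by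
    have h1 := antitone_expNeg (decayRate_le_lintegral_shell hlam hα hs ha hab hx)
    rw [expNeg_add, expNeg_ofReal hc, expNeg_ofReal hD] at h1
    rw [ENNReal.ofReal_mul (Real.exp_pos _).le]
    refine le_trans (le_of_eq ?_) (mul_le_mul_right h1 _)
    rw [mul_left_comm, ← ENNReal.ofReal_mul (Real.exp_pos _).le, ← Real.exp_add]
    simp [hJ]
  rw [hmean, expNeg_zero, mul_one]
  calc _ ≤ ENNReal.ofReal (q l) * (ENNReal.ofReal (constC lam * (b ^ 2 - a ^ 2)) *
        ENNReal.ofReal (Real.exp (constC lam * (b ^ 2 - a ^ 2)) *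
      Real.exp (-(decayRate α lam s (q l) * a ^ 2)))) := by gcongr
    _ = _ := by
      rw [← ENNReal.ofReal_mul hc, ← ENNReal.ofReal_mul hx.1]
      congr 1
      ring

/-- Probability that a shell holds a single station and its gain exceeds the cost measured from the
outer radius, plus a noise term. -/
lemma IsNetwork.le_tsum_measure_shellEvent (hlam : 0 < lam) (hα : 2 < α) {s d : ℝ} (hs : 0 < s)
    (hd : 0 ≤ d) (l : Fin N) (ha : 0 ≤ a) (hab : a < b) :
    ENNReal.ofReal (q l * (constC lam * (b ^ 2 - a ^ 2)) *
        Real.exp (-(constC lam * (b ^ 2 - a ^ 2))) * Real.exp (-(decayRate α lam s (q l) * b ^ 2)) *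
        Real.exp (-d)) ≤
    ∑' i, μ (shellEvent X h cache l α s b a b (ENNReal.ofReal d) {1} i) := by
  have hx : q l ∈ Icc (0 : ℝ) 1 := ⟨hnet.q_nonneg l, hnet.q_le_one l⟩
  have hba : 0 ≤ b ^ 2 - a ^ 2 := sub_nonneg.2 (pow_le_pow_left₀ ha hab.le 2)
  have hc : 0 ≤ constC lam * (b ^ 2 - a ^ 2) := mul_nonneg (constC_pos hlam).le hba
  have hD : 0 ≤ decayRate α lam s (q l) * b ^ 2 :=
    mul_nonneg (decayRate_pos hlam hα hs hx).le (by positivity)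
  rw [hnet.tsum_measure_shellEvent hlam l α s b ha hab.le]
  have hT := measurableSet_shell a b
  have hone : ∫⁻ ω, countWeight {1} (countIn X (shell a b) ω) ∂μ =
      ENNReal.ofReal (constC lam * (b ^ 2 - a ^ 2) *
        Real.exp (-(constC lam * (b ^ 2 - a ^ 2)))) := by
    have hm : MeasurableSet {ω | countIn X (shell a b) ω = 1} :=
      measurable_countIn hnet.poisson.measurable_pos hT (measurableSet_singleton 1)
    have h1 := hnet.poisson.measure_countIn_eq_one hlam hT
      (by rw [volume_shell ha hab.le]; exact ENNReal.ofReal_ne_top)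
    rw [volume_shell ha hab.le, ENNReal.toReal_ofReal (mul_nonneg Real.pi_pos.le hba),
      show lam * (Real.pi * (b ^ 2 - a ^ 2)) = constC lam * (b ^ 2 - a ^ 2) by
        rw [constC]; ring] at h1
    rw [← h1, ← lintegral_indicator_one hm]
    refine lintegral_congr fun ω => ?_
    by_cases hω : countIn X (shell a b) ω = 1 <;> simp [countWeight, hω]
  have hJ := antitone_expNeg (lintegral_shell_le_decayRate hlam hα hs ha hab hx)
  rw [expNeg_ofReal hD] at hJ
  rw [hone, expNeg_ofReal hd]
  refine le_trans (le_of_eq ?_) (mul_le_mul_right (mul_le_mul_right hJ _) _)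
  rw [← ENNReal.ofReal_mul (mul_nonneg hc (Real.exp_pos _).le), ← ENNReal.ofReal_mul hx.1,
    ← ENNReal.ofReal_mul (mul_nonneg hx.1 (Real.exp_pos _).le)]
  congr 1
  ring

/-- Upper bound: the sum over shells is a geometric series. -/
theorem IsNetwork.measureReal_success_le (hlam : 0 < lam) (hα : 2 < α) (hW : 0 < W) (hR₀ : 0 < R₀)
    (hP : 0 < P) (l : Fin N) {n : ℕ} (hn : 0 < n) :
    μ.real (successEvent α W R₀ P noise X h cache l) ≤
      q l * (constC lam / n) * Real.exp (constC lam / n) *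
        (1 - Real.exp (-(decayRate α lam (threshold W R₀) (q l) / n)))⁻¹ := by
  have hs := threshold_pos hW hR₀
  set s := threshold W R₀ with hsdef
  have hx : q l ∈ Icc (0 : ℝ) 1 := ⟨hnet.q_nonneg l, hnet.q_le_one l⟩
  have hn' : (0 : ℝ) < n := by exact_mod_cast hn
  have hD := decayRate_pos hlam hα hs hx
  have hC := constC_pos hlam
  set D := decayRate α lam s (q l)
  set c := q l * (constC lam / n) * Real.exp (constC lam / n) with hcdef
  have hc0 : 0 ≤ c := mul_nonneg (mul_nonneg hx.1 (by positivity)) (Real.exp_pos _).le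
  have he1 : Real.exp (-(D / n)) < 1 := Real.exp_lt_one_iff.2 (by simpa using div_pos hD hn')
  have hgeo := (hasSum_geometric_of_lt_one (Real.exp_pos _).le he1).mul_left c
  have hshell : ∀ k, ∑' i, μ (shellEvent X h cache l α s (radius n k) (radius n k)
      (radius n (k + 1)) 0 univ i) ≤ ENNReal.ofReal (c * Real.exp (-(D / n)) ^ k) := fun k => by
    have := hnet.tsum_measure_shellEvent_le hlam hα hs l (radius_nonneg n k)
      (radius_lt_succ hn k).le
    rw [radius_succ_sq_sub, radius_sq, mul_one_div] at this
    rw [← Real.exp_nat_mul]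
    convert! this using 4
    ring
  have hsub : successEvent α W R₀ P noise X h cache l ⊆
      ⋃ k, ⋃ i, shellEvent X h cache l α s (radius n k) (radius n k) (radius n (k + 1)) 0
        univ i := by
    rintro ω ⟨i, hserve, hrate⟩
    have hXi : X i ω ∈ shell (radius n ⌊n * ‖X i ω‖ ^ 2⌋₊) (radius n (⌊n * ‖X i ω‖ ^ 2⌋₊ + 1)) :=
      (mem_shell_radius_iff hn).2 rfl
    refine mem_iUnion₂.2 ⟨_, i, hXi, mem_univ _, hserve.1, ?_⟩
    rw [add_zero]
    exact cost_le_of_success hα hW hR₀ hP (radius_nonneg _ _) hXi hserve hrate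
  refine ENNReal.toReal_le_of_le_ofReal (mul_nonneg hc0 (inv_nonneg.2 (by linarith))) ?_
  calc μ (successEvent α W R₀ P noise X h cache l)
      ≤ ∑' k, ∑' i, μ (shellEvent X h cache l α s (radius n k) (radius n k)
        (radius n (k + 1)) 0 univ i) :=
        (measure_mono hsub).trans ((measure_iUnion_le _).trans
          (ENNReal.tsum_le_tsum fun k => measure_iUnion_le _))
    _ ≤ ∑' k : ℕ, ENNReal.ofReal (c * Real.exp (-(D / n)) ^ k) := ENNReal.tsum_le_tsum hshell
    _ = _ := by
        rw [← ENNReal.ofReal_tsum_of_nonneg (fun k => by positivity) hgeo.summable, hgeo.tsum_eq]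

/-- Lower bound: requests served by the only station of its shell are disjoint events. -/
theorem IsNetwork.sum_le_measureReal_success (hlam : 0 < lam) (hα : 2 < α) (hW : 0 < W)
    (hR₀ : 0 < R₀) (hP : 0 < P) (hnoise : 0 ≤ noise) (l : Fin N) {n : ℕ} (hn : 0 < n) (M : ℕ) :
    ∑ k ∈ Finset.range M, q l * (constC lam / n) * Real.exp (-(constC lam / n)) *
        Real.exp (-(decayRate α lam (threshold W R₀) (q l) / n)) ^ (k + 1) *
        Real.exp (-(threshold W R₀ * radius n (k + 1) ^ α * (noise / P))) ≤
      μ.real (successEvent α W R₀ P noise X h cache l) := by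
  have hs := threshold_pos hW hR₀
  set s := threshold W R₀ with hsdef
  have hx : q l ∈ Icc (0 : ℝ) 1 := ⟨hnet.q_nonneg l, hnet.q_le_one l⟩
  have hn' : (0 : ℝ) < n := by exact_mod_cast hn
  have hC := constC_pos hlam
  set D := decayRate α lam s (q l)
  let d : ℕ → ℝ := fun k => s * radius n (k + 1) ^ α * (noise / P)
  have hd : ∀ k, 0 ≤ d k := fun k => by
    have := radius_nonneg n (k + 1)
    positivity
  let F : ℕ × ℕ → Set Ω := fun z => shellEvent X h cache l α s (radius n (z.1 + 1)) (radius n z.1)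
    (radius n (z.1 + 1)) (ENNReal.ofReal (d z.1)) {1} z.2
  have hFserve : ∀ z, ∀ ω ∈ F z, Serves X cache l z.2 ω := fun z ω hω =>
    serves_of_cost_le hω.1 hω.2.1 hω.2.2.1 hω.2.2.2
  have hFm : ∀ z, MeasurableSet (F z) := fun z => hnet.measurableSet_shellEvent l _ _ _ _ _ _ _ _
  have hFd : Pairwise (Function.onFun Disjoint F) := by
    rintro ⟨k, i⟩ ⟨k', i'⟩ hne
    refine Set.disjoint_left.2 fun ω hω hω' => hne ?_
    -- both stations serve, hence are equally far and lie in the same shell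
    have h1 := (hFserve _ ω hω).2 i' (hFserve _ ω hω').1
    have h2 := (hFserve _ ω hω').2 i (hFserve _ ω hω).1
    have hk := (mem_shell_radius_iff hn).1 hω.1
    have hk' := (mem_shell_radius_iff hn).1 hω'.1
    simp only at h1 h2 hk hk'
    have hkk : k = k' := by rw [← hk, ← hk', le_antisymm h1 h2]
    subst hkk
    obtain ⟨m, hm⟩ := encard_eq_one.1 hω.2.1
    have hi : i ∈ ({m} : Set ℕ) := hm ▸ hω.1
    have hi' : i' ∈ ({m} : Set ℕ) := hm ▸ hω'.1
    rw [mem_singleton_iff.1 hi, mem_singleton_iff.1 hi']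
  have hsub : ⋃ z, F z ≤ᵐ[μ] successEvent α W R₀ P noise X h cache l := by
    filter_upwards [hnet.ae_pos_ne_zero hlam, hnet.ae_interference_ne_zero (α := α) hlam hP]
      with ω hX0 hI hω
    obtain ⟨z, hz⟩ := mem_iUnion.1 hω
    exact ⟨z.2, hFserve z ω hz, rate_of_cost_le hα hW hR₀ hP hnoise hz.1 (hX0 _) (hI _) hz.2.1
      hz.2.2.2⟩
  have hnn : ∀ k ∈ Finset.range M, 0 ≤ q l * (constC lam / n) * Real.exp (-(constC lam / n)) *
        Real.exp (-(D / n)) ^ (k + 1) * Real.exp (-(d k)) := fun k _ => by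
    have := hx.1
    positivity
  refine (ENNReal.ofReal_le_iff_le_toReal (measure_ne_top _ _)).1 ?_
  rw [ENNReal.ofReal_sum_of_nonneg hnn]
  calc _ ≤ ∑ k ∈ Finset.range M, ∑' i, μ (F (k, i)) := by
        refine Finset.sum_le_sum fun k _ => ?_
        have := hnet.le_tsum_measure_shellEvent hlam hα hs (hd k) l (radius_nonneg n k)
          (radius_lt_succ hn k)
        rw [radius_succ_sq_sub, radius_sq, mul_one_div] at this
        rw [← Real.exp_nat_mul]
        convert! this using 5
        push_cast
        ring
    _ ≤ ∑' k, ∑' i, μ (F (k, i)) := ENNReal.sum_le_tsum _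
    _ = μ (⋃ z, F z) := by rw [measure_iUnion hFd hFm, ENNReal.tsum_prod']
    _ ≤ _ := measure_mono_ae hsub

end Bounds

/-! ### Refining the shells -/

section Limit

open Filter Topology

lemma tendsto_div_mul_inv_one_sub_exp (C : ℝ) {D : ℝ} (hD : 0 < D) :
    Tendsto (fun n : ℕ => C / n * (1 - Real.exp (-(D / n)))⁻¹) atTop (𝓝 (C / D)) := by
  have hderiv : HasDerivAt (fun t : ℝ => 1 - Real.exp (-(D * t))) D 0 := by
    have h1 : HasDerivAt (fun t : ℝ => -(D * t)) (-D) 0 := by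
      simpa using ((hasDerivAt_id (0 : ℝ)).const_mul D).fun_neg
    simpa using h1.exp.const_sub 1
  have hslope := hderiv.tendsto_slope_zero_right
  have hn : Tendsto (fun n : ℕ => (n : ℝ)⁻¹) atTop (𝓝[>] 0) :=
    tendsto_inv_atTop_nhdsGT_zero.comp tendsto_natCast_atTop_atTop
  have h2 := ((hslope.comp hn).inv₀ hD.ne').const_mul C
  refine h2.congr fun n => ?_
  simp only [Function.comp, smul_eq_mul, zero_add, mul_zero, neg_zero, Real.exp_zero, sub_self,
    sub_zero, inv_inv, mul_inv]
  rw [← mul_assoc]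
  simp only [div_eq_mul_inv]

lemma tendsto_exp_div_natCast (C : ℝ) :
    Tendsto (fun n : ℕ => Real.exp (C / n)) atTop (𝓝 1) := by
  have := (Real.continuous_exp.tendsto 0).comp (tendsto_const_div_atTop_nhds_zero_nat C)
  rwa [Real.exp_zero] at this

variable {Ω : Type*} [MeasurableSpace Ω] {μ : Measure Ω} [IsProbabilityMeasure μ] {N L : ℕ}
  {lam α W R₀ : ℝ} {q : Fin N → ℝ}
  {X : ℕ → Ω → Plane} {h : ℕ → Ω → ℝ} {cache : ℕ → Ω → Set (Fin N)}
  (hnet : IsNetwork μ lam L q X h cache)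
include hnet

lemma IsNetwork.measureReal_success_le_g₀ (hlam : 0 < lam) (hα : 2 < α) (hW : 0 < W)
    (hR₀ : 0 < R₀) (l : Fin N) {P : ℝ} (hP : 0 < P) (noise : ℝ) :
    μ.real (successEvent α W R₀ P noise X h cache l) ≤ g₀ α lam (threshold W R₀) (q l) := by
  have hs := threshold_pos hW hR₀
  have hx : q l ∈ Icc (0 : ℝ) 1 := ⟨hnet.q_nonneg l, hnet.q_le_one l⟩
  have hD := decayRate_pos hlam hα hs hx
  rw [g₀_eq hlam hα hs hx]
  have h1 := ((tendsto_div_mul_inv_one_sub_exp (constC lam) hD).const_mul (q l)).mul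
    (tendsto_exp_div_natCast (constC lam))
  rw [mul_one, ← mul_div_assoc] at h1
  refine ge_of_tendsto h1 ?_
  filter_upwards [eventually_gt_atTop 0] with n hn
  refine (hnet.measureReal_success_le hlam hα hW hR₀ hP l hn).trans (le_of_eq ?_)
  ring

/-- The lower bound is uniform in small noise-to-power ratios. -/
lemma IsNetwork.exists_lt_measureReal_success (hlam : 0 < lam) (hα : 2 < α) (hW : 0 < W)
    (hR₀ : 0 < R₀) (l : Fin N) {η : ℝ} (hη : η < g₀ α lam (threshold W R₀) (q l)) :
    ∃ δ > 0, ∀ P noise : ℝ, 0 < P → 0 ≤ noise → noise / P < δ →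
      η < μ.real (successEvent α W R₀ P noise X h cache l) := by
  have hs := threshold_pos hW hR₀
  have hx : q l ∈ Icc (0 : ℝ) 1 := ⟨hnet.q_nonneg l, hnet.q_le_one l⟩
  have hD := decayRate_pos hlam hα hs hx
  rw [g₀_eq hlam hα hs hx] at hη
  set s := threshold W R₀ with hsdef
  set D := decayRate α lam s (q l) with hDdef
  have h1 := (((tendsto_div_mul_inv_one_sub_exp (constC lam) hD).const_mul (q l)).mul
    (tendsto_exp_div_natCast (-constC lam))).mul (tendsto_exp_div_natCast (-D))
  rw [mul_one, mul_one, ← mul_div_assoc] at h1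
  obtain ⟨n, hlt, hn⟩ := ((h1.eventually (lt_mem_nhds hη)).and (eventually_gt_atTop 0)).exists
  have hn' : (0 : ℝ) < n := by exact_mod_cast hn
  have he1 : Real.exp (-(D / n)) < 1 := Real.exp_lt_one_iff.2 (by simpa using div_pos hD hn')
  let S : ℕ → ℝ → ℝ := fun M ρ => ∑ k ∈ Finset.range M,
    q l * (constC lam / n) * Real.exp (-(constC lam / n)) * Real.exp (-(D / n)) ^ (k + 1) *
      Real.exp (-(s * radius n (k + 1) ^ α * ρ))
  -- without noise the truncated sums converge to the full geometric series
  have h2 : Tendsto (fun M => S M 0) atTop (𝓝 (q l * (constC lam / n *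
      (1 - Real.exp (-(D / n)))⁻¹) * Real.exp (-constC lam / n) * Real.exp (-D / n))) := by
    have hgeo := ((hasSum_geometric_of_lt_one (Real.exp_pos _).le he1).mul_left
      (q l * (constC lam / n) * Real.exp (-(constC lam / n)) * Real.exp (-(D / n)))).tendsto_sum_nat
    convert! hgeo using 2
    · refine Finset.sum_congr rfl fun k _ => ?_
      rw [mul_zero, neg_zero, Real.exp_zero, mul_one, pow_succ']
      ring
    · rw [neg_div, neg_div]
      ring
  obtain ⟨M, hM⟩ := (h2.eventually (lt_mem_nhds hlt)).exists
  have hcont : Continuous (S M) := by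
    dsimp only [S]
    fun_prop
  obtain ⟨δ, hδ, hball⟩ := Metric.eventually_nhds_iff.1
    ((hcont.tendsto 0).eventually (lt_mem_nhds hM))
  refine ⟨δ, hδ, fun P noise hP hnoise hlt' => ?_⟩
  refine (hball (y := noise / P) ?_).trans_le
    (hnet.sum_le_measureReal_success hlam hα hW hR₀ hP hnoise l hn M)
  rwa [Real.dist_0_eq_abs, abs_of_nonneg (by positivity)]

/-- Without noise the success probability of each file is `g₀`. -/
theorem IsNetwork.measureReal_success_eq_g₀ (hlam : 0 < lam) (hα : 2 < α) (hW : 0 < W)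
    (hR₀ : 0 < R₀) (l : Fin N) {P : ℝ} (hP : 0 < P) :
    μ.real (successEvent α W R₀ P 0 X h cache l) = g₀ α lam (threshold W R₀) (q l) := by
  refine le_antisymm (hnet.measureReal_success_le_g₀ hlam hα hW hR₀ l hP 0)
    (le_of_forall_lt fun η hη => ?_)
  obtain ⟨δ, hδ, H⟩ := hnet.exists_lt_measureReal_success hlam hα hW hR₀ l hη
  exact H P 0 hP le_rfl (by simpa using hδ)

end Limit

end CachingNetwork

open CachingNetwork in
theorem mainTheorem2 {Ω : Type*} [MeasurableSpace Ω] (μ : Measure Ω) [IsProbabilityMeasure μ]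
    {N : ℕ} (L : ℕ) (lam α W R₀ : ℝ) (hlam : 0 < lam) (hα : 2 < α) (hW : 0 < W) (hR₀ : 0 < R₀)
    (p q : Fin N → ℝ) (hp : ∀ l, 0 ≤ p l) (hp_sum : ∑ l, p l = 1)
    (X : ℕ → Ω → Plane) (h : ℕ → Ω → ℝ) (cache : ℕ → Ω → Set (Fin N))
    (hnet : IsNetwork μ lam L q X h cache) :
    -- without noise, the average success probability is given by `g₀`
    (∀ P : ℝ, 0 < P →
      avgSuccessProb μ α W R₀ P 0 p X h cache = ∑ l, p l * g₀ α lam (threshold W R₀) (q l)) ∧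
    -- at high signal-to-noise ratio the same expression is the limit
    (∀ ε : ℝ, 0 < ε → ∃ K : ℝ, ∀ P noise : ℝ, 0 < P → 0 < noise → K ≤ P / noise →
      |avgSuccessProb μ α W R₀ P noise p X h cache
        - ∑ l, p l * g₀ α lam (threshold W R₀) (q l)| < ε) ∧
    -- the integrals that define `A`, `B` and `g₀` converge, and `g₀` has the closed form
    IntegrableOn (fun u : ℝ => u ^ (2 / α - 1) / (1 + u)) (Ioi (1 / threshold W R₀)) ∧
    IntegrableOn (fun u : ℝ => u ^ (2 / α - 1) / (1 + u)) (Ioi 0) ∧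
    (∀ x ∈ Icc (0 : ℝ) 1,
      IntegrableOn (fun t : ℝ => Real.exp (-(decayRate α lam (threshold W R₀) x) * t)) (Ioi 0) ∧
      g₀ α lam (threshold W R₀) x =
        x * constC lam / (x * constA α lam (threshold W R₀)
          + (1 - x) * constB α lam (threshold W R₀) + x * constC lam)) := by
  have hs := threshold_pos hW hR₀
  refine ⟨fun P hP => ?_, fun ε hε => ?_,
    (integrableOn_rpow_div_one_add hα).mono_set (Ioi_subset_Ioi (one_div_pos.2 hs).le),
    integrableOn_rpow_div_one_add hα, fun x hx =>
      ⟨integrableOn_exp_decayRate hlam hα hs hx, g₀_eq hlam hα hs hx⟩⟩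
  · exact Finset.sum_congr rfl fun l _ => by
      rw [hnet.measureReal_success_eq_g₀ hlam hα hW hR₀ l hP]
  · have hloss : ∀ l, ∃ δ > 0, ∀ P noise : ℝ, 0 < P → 0 ≤ noise → noise / P < δ →
        g₀ α lam (threshold W R₀) (q l) - ε / 2 <
          μ.real (successEvent α W R₀ P noise X h cache l) := fun l =>
      hnet.exists_lt_measureReal_success hlam hα hW hR₀ l (by linarith)
    choose δ hδ H using hloss
    -- a ratio `P / noise` above every `1 / δ l` serves all files at once
    have hK : ∀ᶠ K : ℝ in Filter.atTop, ∀ l, 1 / δ l < K :=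
      Filter.eventually_all.2 fun l => Filter.eventually_gt_atTop _
    obtain ⟨K, hK⟩ := hK.exists
    refine ⟨K, fun P noise hP hnoise hKP => ?_⟩
    rw [avgSuccessProb, ← Finset.sum_sub_distrib]
    calc |∑ l, (p l * μ.real (successEvent α W R₀ P noise X h cache l) -
            p l * g₀ α lam (threshold W R₀) (q l))|
        ≤ ∑ l, |p l * μ.real (successEvent α W R₀ P noise X h cache l) -
            p l * g₀ α lam (threshold W R₀) (q l)| := Finset.abs_sum_le_sum_abs _ _
      _ ≤ ∑ l, p l * (ε / 2) := by
          refine Finset.sum_le_sum fun l _ => ?_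
          rw [← mul_sub, abs_mul, abs_of_nonneg (hp l)]
          refine mul_le_mul_of_nonneg_left ?_ (hp l)
          have hratio : noise / P < δ l := by
            have h1 : 1 / δ l < P / noise := (hK l).trans_le hKP
            have h2 := (one_div_lt (hδ l) (div_pos hP hnoise)).1 h1
            rwa [one_div_div] at h2
          have h1 := H l P noise hP hnoise.le hratio
          have h2 := hnet.measureReal_success_le_g₀ hlam hα hW hR₀ l hP noise
          exact abs_le.2 ⟨by linarith, by linarith⟩
      _ = ε / 2 := by rw [← Finset.sum_mul, hp_sum, one_mul]
      _ < ε := by linarith
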